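/- Let $\mathbb{K}$ be a field of characteristic zero. A \emph{complete filtered} associative (respectively Lie) algebra over $\mathbb{K}$ is an associative algebra, unital or not (respectively a Lie algebra), $A$ with a decreasing filtration $A=A_0\supseteq A_1\supseteq A_2\supseteq\cdots$ by subspaces such that $A_mA_n\subseteq A_{m+n}$ (respectively $[A_m,A_n]\subseteq A_{m+n}$) for all $m,n\ge 0$ and such that the canonical map $A\to\varprojlim A/A_n$ is bijective. Limits and infinite sums are taken in the topology defined by the filtration. \emph{Exponential.} For $a\in A_1$ put $\exp(a)=\sum_{n\ge 0}a^n/n!$. This is an element of $A$ if $A$ is a unital associative algebra, of the algebra $\mathbb{K}\oplus A$ obtained by adjoining a unit if $A$ is an associative algebra not assumed to be unital, and of the completed enveloping algebra $\varprojlim \mathcal{U}(A)/\mathcal{U}(A)_n$ if $A$ is a Lie algebra, where $\mathcal{U}(A)_n$ is the ideal spanned by the products $x_1\cdots x_k$ with $x_j\in A_{i_j}$ and $i_1+\cdots+i_k\ge n$. \emph{Baker--Campbell--Hausdorff series.} Let $C(x,y)=\log(\exp(x)\exp(y))\in\mathbb{Q}\langle\langle x,y\rangle\rangle$ and $\mathrm{BCH}(x,y)=C(x,y)-x-y$.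 For $u,v\in A_1$, $C(u,v)$ denotes the sum of the values at $(u,v)$ of the homogeneous components of $C(x,y)$. In the Lie case one uses that these components are Lie polynomials: if the component of degree $n\ge1$ is $\sum_{|w|=n}c_w w$, its value in a Lie algebra is $\frac1n\sum_{w=w_1\cdots w_n}c_w[w_1,[w_2,\dots[w_{n-1},w_n]\cdots]]$ (just $\sum_w c_w w$ if $n=1$), with $u,v$ substituted for $x,y$. \emph{The recursion.} Let $P:A\to A$ be a linear map with $P(A_n)\subseteq A_n$ for all $n$, and let $\tilde P=\mathrm{id}_A-P$. For $a\in A_1$ let $\chi(a)=\lim_{n\to\infty}\chi_{(n)}(a)$, where $\chi_{(0)}(a)=a$ and $\chi_{(n+1)}(a)=a-\mathrm{BCH}\big(P(\chi_{(n)}(a)),\tilde P(\chi_{(n)}(a))\big)$. Let $D_P(a)=\big(P(\chi(a)),\tilde P(\chi(a))\big)$. \textbf{Theorem.} Let $A$ be a complete filtered associative algebra or a complete filtered Lie algebra, with a linear filtration-preserving map $P:A\to A$. Then the above series and limits converge, $C$ maps $A_1\times A_1$ to $A_1$ with $\exp(u)\exp(v)=\exp(C(u,v))$ for $u,v\in A_1$,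 $\chi$ maps $A_1$ to $A_1$, and: \begin{enumerate} \item for every $a\in A_1$, $\exp(a)=\exp\big(P(\chi(a))\big)\exp\big(\tilde P(\chi(a))\big)$; \item $D_P:A_1\to A_1\times A_1$ is a right inverse of $C:A_1\times A_1\to A_1$, that is, $C(D_P(a))=a$ for every $a\in A_1$; \item $C$ restricts to a bijection $D_P(A_1)\to A_1$; \item for every subset $B\subseteq A_1$, $C$ restricts to a bijection $D_P(B)\to B$. \end{enumerate} -/

import Mathlib

open scoped PowerSeries

noncomputable section

namespace BCHRec

/-! ### Filtrations, their topology, limits -/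

section Filtration

variable {K M : Type*} [Semiring K] [AddCommGroup M] [Module K M]

/-- `F` is a complete decreasing filtration `M = F 0 ⊇ F 1 ⊇ ⋯` by subspaces, compatible with the
product `op` of `M`: `op (F m) (F n) ⊆ F (m + n)` (so each `F n` is a subalgebra), and the canonical
map `M → lim M / F n` is injective (`separated`) and surjective (`complete`). -/
structure IsCompleteFiltration (op : M → M → M) (F : ℕ → Submodule K M) : Prop where
  zero_eq_top : F 0 = ⊤
  antitone : Antitone F
  op_mem : ∀ m n : ℕ, ∀ x ∈ F m, ∀ y ∈ F n, op x y ∈ F (m + n)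
  separated : ∀ x : M, (∀ n, x ∈ F n) → x = 0
  complete : ∀ f : ℕ → M, (∀ m n, m ≤ n → f m - f n ∈ F m) → ∃ l, ∀ n, f n - l ∈ F n

/-- Convergence of sequences in the topology defined by the filtration `F`. -/
def Converges (F : ℕ → Submodule K M) (u : ℕ → M) (l : M) : Prop :=
  ∀ n, ∃ N, ∀ k, N ≤ k → u k - l ∈ F n

open Classical in
/-- The limit of a sequence in the topology defined by `F` (`0` if there is none). -/
def limit (F : ℕ → Submodule K M) (u : ℕ → M) : M :=
  if h : ∃ l, Converges F u l then h.choose else 0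

end Filtration

/-! ### The exponential -/

section Exp

variable {K E : Type*} [Field K] [Ring E] [Algebra K E]

/-- Partial sums of the exponential series. -/
def expPartial (K : Type*) {E : Type*} [Field K] [Ring E] [Algebra K E] (a : E) (N : ℕ) : E :=
  ∑ k ∈ Finset.range N, ((k.factorial : K)⁻¹) • a ^ k

/-- `exp a = ∑ aᵏ / k!`, the sum being taken in the topology defined by `F`. -/
def filExp (F : ℕ → Submodule K E) (a : E) : E :=
  limit F (expPartial K a)

end Exp

/-! ### The Baker--Campbell--Hausdorff series

The two letters are `0` (for `x`) and `1` (for `y`). The series algebra `ℚ⟨⟨x, y⟩⟩` is handled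
by means of a central variable `t` that records the degree: `x` and `y` are replaced by
`x t` and `y t` in `ℚ⟨x, y⟩⟦t⟧`. -/

/-- The algebra `ℚ⟨x, y⟩` of noncommutative polynomials in two letters, with basis the words. -/
abbrev NCPoly : Type := MonoidAlgebra ℚ (FreeMonoid (Fin 2))

/-- `exp (z t)` where `z` is the letter `i`. -/
def expLetter (i : Fin 2) : NCPoly⟦X⟧ :=
  PowerSeries.mk fun n => ((n.factorial : ℚ)⁻¹) • (MonoidAlgebra.of ℚ _ (FreeMonoid.of i)) ^ n

/-- The coefficient of the word `w` in `log (exp x * exp y) ∈ ℚ⟨⟨x, y⟩⟩`, where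
`log (1 + z) = ∑_{k ≥ 1} (-1) ^ (k + 1) zᵏ / k`. As `z = exp x * exp y - 1` has no constant term,
only the terms with `k ≤ |w|` contribute. -/
def bchCoeff (w : List (Fin 2)) : ℚ :=
  ∑ k ∈ Finset.Icc 1 w.length, ((-1) ^ (k + 1) / (k : ℚ)) *
    (PowerSeries.coeff w.length ((expLetter 0 * expLetter 1 - 1) ^ k)).coeff (FreeMonoid.ofList w)

/-- The right-nested product `op z₁ (op z₂ (⋯ zₙ))` of the values of the letters of a word. -/
def wordEval {M : Type*} [Zero M] (op : M → M → M) (f : Fin 2 → M) : List (Fin 2) → M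
  | [] => 0
  | [i] => f i
  | i :: j :: w => op (f i) (wordEval op f (j :: w))

section Eval

variable {K : Type*} [Field K]

/-- The value at `(u, v)` of the component of degree `n` of `log (exp x * exp y)` in an associative
algebra: a linear combination of the words of length `n` (the constant term vanishes). -/
def assocComponent (K : Type*) [Field K] {A : Type*} [NonUnitalRing A] [Module K A]
    (n : ℕ) (u v : A) : A :=
  ∑ w : Fin n → Fin 2,
    (bchCoeff (List.ofFn w) : K) • wordEval (fun a b => a * b) ![u, v] (List.ofFn w)

/-- The value at `(u, v)` of the component of degree `n` of `log (exp x * exp y)` in a Lie algebra.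
This component is a Lie polynomial, which is written in terms of brackets by means of Dynkin's
operator: a homogeneous Lie polynomial `∑ c_w w` of degree `n` equals
`(1 / n) ∑ c_w [w₁, [w₂, [⋯, wₙ]]]`. -/
def lieComponent (K : Type*) [Field K] {L : Type*} [LieRing L] [LieAlgebra K L]
    (n : ℕ) (u v : L) : L :=
  ((n : K)⁻¹) • ∑ w : Fin n → Fin 2,
    (bchCoeff (List.ofFn w) : K) • wordEval (fun a b => ⁅a, b⁆) ![u, v] (List.ofFn w)

/-- Partial sums of the series `C(u, v)` in an associative algebra. -/
def assocCPartial (K : Type*) [Field K] {A : Type*} [NonUnitalRing A] [Module K A]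
    (u v : A) (N : ℕ) : A :=
  ∑ n ∈ Finset.range N, assocComponent K n u v

/-- `C(u, v) = u + v + BCH(u, v)` in a filtered associative algebra. -/
def assocC {A : Type*} [NonUnitalRing A] [Module K A] (F : ℕ → Submodule K A) (u v : A) : A :=
  limit F (assocCPartial K u v)

/-- Partial sums of the series `C(u, v)` in a Lie algebra. -/
def lieCPartial (K : Type*) [Field K] {L : Type*} [LieRing L] [LieAlgebra K L]
    (u v : L) (N : ℕ) : L :=
  ∑ n ∈ Finset.range N, lieComponent K n u v

/-- `C(u, v) = u + v + BCH(u, v)` in a filtered Lie algebra. -/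
def lieC {L : Type*} [LieRing L] [LieAlgebra K L] (F : ℕ → Submodule K L) (u v : L) : L :=
  limit F (lieCPartial K u v)

end Eval

/-! ### The recursion -/

section Recursion

variable {K M : Type*} [Field K] [AddCommGroup M] [Module K M]

/-- `P̃ = id - P`. -/
def tilde (P : M →ₗ[K] M) : M →ₗ[K] M := LinearMap.id - P

/-- `BCH(u, v) = C(u, v) - u - v`. -/
def bch (C : M → M → M) (u v : M) : M := C u v - u - v

/-- `χ₍₀₎(a) = a`, `χ₍ₙ₊₁₎(a) = a - BCH(P(χ₍ₙ₎(a)), P̃(χ₍ₙ₎(a)))`. -/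
def chiSeq (C : M → M → M) (P : M →ₗ[K] M) (a : M) : ℕ → M
  | 0 => a
  | n + 1 => a - bch C (P (chiSeq C P a n)) (tilde P (chiSeq C P a n))

/-- `χ(a) = lim χ₍ₙ₎(a)` in the topology defined by `F`. -/
def chi (F : ℕ → Submodule K M) (C : M → M → M) (P : M →ₗ[K] M) (a : M) : M :=
  limit F (chiSeq C P a)

/-- `D_P = (P ∘ χ, P̃ ∘ χ)`. -/
def DP (F : ℕ → Submodule K M) (C : M → M → M) (P : M →ₗ[K] M) (a : M) : M × M :=
  (P (chi F C P a), tilde P (chi F C P a))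

/-- The factorization statement for `M` with filtration `F`, the map `C`, the filtration-preserving
map `P`, and an exponential map `e` with values in a ring. -/
structure Factorization {E : Type*} [Ring E] (F : ℕ → Submodule K M) (C : M → M → M)
    (P : M →ₗ[K] M) (e : M → E) : Prop where
  /-- `C` maps `F 1 × F 1` to `F 1`. -/
  C_mem : ∀ u ∈ F 1, ∀ v ∈ F 1, C u v ∈ F 1
  /-- `C` is the Baker--Campbell--Hausdorff product: `exp u * exp v = exp (C(u, v))`. -/
  exp_mul_exp : ∀ u ∈ F 1, ∀ v ∈ F 1, e u * e v = e (C u v)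
  /-- The limit `χ(a)` exists for `a ∈ F 1`. -/
  chi_converges : ∀ a ∈ F 1, Converges F (chiSeq C P a) (chi F C P a)
  /-- `χ` maps `F 1` to `F 1`. -/
  chi_mem : ∀ a ∈ F 1, chi F C P a ∈ F 1
  /-- `exp a = exp (P (χ a)) * exp (P̃ (χ a))`. -/
  exp_eq : ∀ a ∈ F 1, e a = e (P (chi F C P a)) * e (tilde P (chi F C P a))
  /-- `D_P` maps `F 1` to `F 1 × F 1`. -/
  DP_mapsTo : Set.MapsTo (DP F C P) (F 1 : Set M) ((F 1 : Set M) ×ˢ (F 1 : Set M))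
  /-- `D_P` is a right inverse of `C`. -/
  rightInv : ∀ a ∈ F 1, C (DP F C P a).1 (DP F C P a).2 = a
  /-- `C` restricts to a bijection `D_P(F 1) → F 1`. -/
  bijOn : Set.BijOn (fun p : M × M => C p.1 p.2) (DP F C P '' (F 1 : Set M)) (F 1 : Set M)
  /-- `C` restricts to a bijection `D_P(B) → B` for every subset `B` of `F 1`. -/
  bijOn_subset : ∀ B : Set M, B ⊆ (F 1 : Set M) →
    Set.BijOn (fun p : M × M => C p.1 p.2) (DP F C P '' B) B

end Recursion

/-! ### Adjoining a unit -/

/-- The subspaces `F n` of a not necessarily unital algebra `A`, seen inside the algebra `K ⊕ A`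
obtained by adjoining a unit. -/
def unitizationFil {K A : Type*} [Field K] [NonUnitalRing A] [Module K A]
    (F : ℕ → Submodule K A) : ℕ → Submodule K (Unitization K A) :=
  fun n => (F n).map (Unitization.inrHom K K A)

/-! ### The completed enveloping algebra of a filtered Lie algebra -/

section Enveloping

variable {K L : Type*} [Field K] [LieRing L] [LieAlgebra K L]

/-- The filtration of the enveloping algebra `U(L)` induced by `F`: the ideal generated by the
products `x₁ ⋯ xₖ` with `xⱼ ∈ F iⱼ` and `i₁ + ⋯ + iₖ ≥ n`. (When `F 0 = ⊤`, these products
already span it as a subspace.) -/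
def envIdeal (F : ℕ → Submodule K L) (n : ℕ) : TwoSidedIdeal (UniversalEnvelopingAlgebra K L) :=
  TwoSidedIdeal.span {x | ∃ l : List (ℕ × L), (∀ p ∈ l, p.2 ∈ F p.1) ∧
    n ≤ (l.map Prod.fst).sum ∧ x = (l.map fun p => UniversalEnvelopingAlgebra.ι K p.2).prod}

/-- The completed enveloping algebra `lim U(L) / U(L)ₙ`: the families of classes, any two of which
have a common representative. -/
def envCompletion (F : ℕ → Submodule K L) :
    Subalgebra K (∀ n, (envIdeal F n).ringCon.Quotient) where
  carrier := {f | ∀ m n, m ≤ n → ∃ x : UniversalEnvelopingAlgebra K L,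
    (x : (envIdeal F m).ringCon.Quotient) = f m ∧ (x : (envIdeal F n).ringCon.Quotient) = f n}
  mul_mem' := by
    intro f g hf hg m n hmn
    obtain ⟨x, hx, hx'⟩ := hf m n hmn
    obtain ⟨y, hy, hy'⟩ := hg m n hmn
    exact ⟨x * y, by simp [hx, hy], by simp [hx', hy']⟩
  add_mem' := by
    intro f g hf hg m n hmn
    obtain ⟨x, hx, hx'⟩ := hf m n hmn
    obtain ⟨y, hy, hy'⟩ := hg m n hmn
    exact ⟨x + y, by simp [hx, hy], by simp [hx', hy']⟩
  algebraMap_mem' := by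
    intro r m n _
    exact ⟨algebraMap K _ r, rfl, rfl⟩

/-- The filtration of the completed enveloping algebra by the kernels of the projections to
`U(L) / U(L)ₙ`. -/
def envCompletionFil (F : ℕ → Submodule K L) (n : ℕ) : Submodule K (envCompletion F) :=
  LinearMap.ker ((LinearMap.proj n :
    (∀ n, (envIdeal F n).ringCon.Quotient) →ₗ[K] (envIdeal F n).ringCon.Quotient) ∘ₗ
      (envCompletion F).val.toLinearMap)

/-- The canonical map from `L` to its completed enveloping algebra. -/
def toEnvCompletion (F : ℕ → Submodule K L) (a : L) : envCompletion F :=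
  ⟨fun _ => (UniversalEnvelopingAlgebra.ι K a : UniversalEnvelopingAlgebra K L),
    fun _ _ _ => ⟨UniversalEnvelopingAlgebra.ι K a, rfl, rfl⟩⟩

end Enveloping

end BCHRec

end

open scoped PowerSeries

noncomputable section

namespace BCHRec

/-! ### Exponential and logarithm of power series with noncommutative coefficients -/

section SeriesExp

variable {T T' : Type*} [Ring T] [Algebra ℚ T] [Ring T'] [Algebra ℚ T']

open PowerSeries Finset

/-! The proof has two independent halves, joined in `IsExpSetting.main`.

The recursion is a contraction argument. The components of `C` of degree at least two are
combinations of products of two or more letters, so moving arguments of `F 1` by elements of `F k`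
moves `bch` by an element of `F (k + 1)` (`wordEval_sub_mem`, `IsComponents.bch_sub_bch_mem`). Hence
`chiSeq` is Cauchy, and its limit `x` satisfies `x = a - BCH(P x, P̃ x)`. Since `P x + P̃ x = x`,
this says `C(P x, P̃ x) = a` (`IsComponents.seriesC_chi`), and the bijections are formal
consequences.

The identity `exp u * exp v = exp (C(u, v))` comes from the formal identity `serExp_bchSeries`, an
instance of `exp (log (1 + z)) = 1 + z`, which reduces to rational series in one variable. Cut off
at degree `N`, the formal identity fails only by homogeneous terms of degree at least `N`; evaluated
at `u`, `v`, these are small (`expPartial_mul_expPartial_sub_mem`).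

In the Lie case the bracket form of each component must have the right image in the enveloping
algebra. The letters are primitive, so their exponentials are group-like and `log (exp x * exp y)`
is primitive (`map_coproduct_bchSeries`). The convolution of Dynkin's operator with the identity is
the Euler operator, so Dynkin's operator multiplies a primitive element of degree `n` by `n`
(`dynkin_coeff_bchSeries`). -/

/-- `∑ fᵏ / k!`, for a power series `f` without constant term. -/
def serExp (f : T⟦X⟧) : T⟦X⟧ :=
  mk fun n => ∑ k ∈ range (n + 1), ((k.factorial : ℚ)⁻¹) • coeff n (f ^ k)

/-- `log (1 + z) = ∑ (-1) ^ (k + 1) zᵏ / k`, for a power series `z` without constant term. -/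
def serLog (z : T⟦X⟧) : T⟦X⟧ :=
  mk fun n => ∑ k ∈ Icc 1 n, ((-1) ^ (k + 1) / (k : ℚ)) • coeff n (z ^ k)

omit [Algebra ℚ T] in
theorem coeff_pow_eq_zero {f : T⟦X⟧} (hf : constantCoeff f = 0) {n k : ℕ} (h : n < k) :
    coeff n (f ^ k) = 0 :=
  coeff_of_lt_order n
    (lt_of_lt_of_le (by exact_mod_cast h) (le_order_pow_of_constantCoeff_eq_zero k hf))

theorem coeff_serExp {f : T⟦X⟧} (hf : constantCoeff f = 0) {n N : ℕ} (h : n < N) :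
    coeff n (serExp f) = coeff n (∑ k ∈ range N, ((k.factorial : ℚ)⁻¹) • f ^ k) := by
  rw [serExp, coeff_mk, map_sum]
  simp only [coeff_smul]
  refine sum_subset (range_subset_range.2 h) fun k _ hk => ?_
  rw [coeff_pow_eq_zero hf (by simpa using hk), smul_zero]

/-- The sum may start at `k = 0` because the coefficient there is `-1 / 0 = 0`. -/
theorem coeff_serLog {z : T⟦X⟧} (hz : constantCoeff z = 0) {n N : ℕ} (h : n < N) :
    coeff n (serLog z) = coeff n (∑ k ∈ range N, ((-1) ^ (k + 1) / (k : ℚ)) • z ^ k) := by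
  rw [serLog, coeff_mk, map_sum]
  simp only [coeff_smul]
  refine sum_subset (fun k hk => ?_) fun k _ hk => ?_
  · simp only [mem_Icc, mem_range] at *; omega
  · rcases Nat.eq_zero_or_pos k with rfl | hk0
    · simp
    · rw [coeff_pow_eq_zero hz (by simp only [mem_Icc] at hk; omega), smul_zero]

theorem constantCoeff_serLog (z : T⟦X⟧) : constantCoeff (serLog z) = 0 := by
  rw [← coeff_zero_eq_constantCoeff_apply, serLog, coeff_mk]; simp

theorem map_serExp (φ : T →ₐ[ℚ] T') (f : T⟦X⟧) :
    PowerSeries.map (φ : T →+* T') (serExp f) = serExp (PowerSeries.map (φ : T →+* T') f) := by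
  ext n
  simp only [coeff_map, serExp, coeff_mk, map_sum, ← map_pow]
  refine sum_congr rfl fun k _ => ?_
  simp

-- The square splits along the diagonals `p.1 + p.2 = k`; those with `k ≥ N` carry only zeros, which
-- leaves the triangle.
omit [Algebra ℚ T] in
theorem sum_antidiagonal_eq_sum_product {N : ℕ} (F : ℕ × ℕ → T)
    (hF : ∀ p, N ≤ p.1 + p.2 → F p = 0) :
    ∑ k ∈ range N, ∑ p ∈ antidiagonal k, F p = ∑ p ∈ range N ×ˢ range N, F p := by
  have h1 : ∑ p ∈ range N ×ˢ range N, F p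
      = ∑ p ∈ (range N ×ˢ range N).filter (fun p => p.1 + p.2 < N), F p := by
    refine (sum_filter_of_ne fun p _ hp => ?_).symm
    by_contra h
    exact hp (hF p (not_lt.1 h))
  rw [h1, ← sum_fiberwise_of_maps_to (t := range N) (g := fun p : ℕ × ℕ => p.1 + p.2)
    (fun p hp => by simpa using (mem_filter.1 hp).2)]
  refine sum_congr rfl fun k hk => sum_congr ?_ fun _ _ => rfl
  ext ⟨a, b⟩
  simp only [HasAntidiagonal.mem_antidiagonal, mem_filter, mem_product, mem_range] at *
  omega

/-- The binomial theorem for commuting elements. In degree `n` both exponentials may be truncated,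
and the pairs of exponents with sum above `n` drop out because their products have too high an
order. -/
theorem serExp_add {f g : T⟦X⟧} (hf : constantCoeff f = 0) (hg : constantCoeff g = 0)
    (h : Commute f g) : serExp (f + g) = serExp f * serExp g := by
  ext n
  have hfg : constantCoeff (f + g) = 0 := by simp [hf, hg]
  have key : coeff n (serExp f * serExp g) =
      coeff n ((∑ k ∈ range (n + 1), ((k.factorial : ℚ)⁻¹) • f ^ k) *
        ∑ k ∈ range (n + 1), ((k.factorial : ℚ)⁻¹) • g ^ k) := by
    rw [coeff_mul, coeff_mul]
    refine sum_congr rfl fun p hp => ?_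
    rw [HasAntidiagonal.mem_antidiagonal] at hp
    rw [coeff_serExp hf (show p.1 < n + 1 by omega), coeff_serExp hg (show p.2 < n + 1 by omega)]
  rw [key, coeff_serExp hfg (Nat.lt_succ_self n), sum_mul_sum, ← sum_product', map_sum, map_sum]
  rw [← sum_antidiagonal_eq_sum_product (N := n + 1)
    (F := fun p => coeff n (((p.1.factorial : ℚ)⁻¹ • f ^ p.1) * ((p.2.factorial : ℚ)⁻¹ • g ^ p.2)))]
  · refine sum_congr rfl fun k _ => ?_
    rw [h.add_pow', smul_sum, map_sum]
    refine sum_congr rfl fun p hp => ?_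
    rw [HasAntidiagonal.mem_antidiagonal] at hp
    subst hp
    rw [smul_mul_smul_comm, coeff_smul, ← Nat.cast_smul_eq_nsmul ℚ, coeff_smul, smul_smul, coeff_smul,
      Nat.cast_add_choose]
    congr 1
    have := Nat.factorial_ne_zero (p.1 + p.2)
    field_simp
  · intro p hp
    have h1 := le_order_pow_of_constantCoeff_eq_zero p.1 hf
    have h2 := le_order_pow_of_constantCoeff_eq_zero p.2 hg
    rw [smul_mul_smul_comm, coeff_smul, coeff_of_lt_order n, smul_zero]
    refine lt_of_lt_of_le ?_ ((add_le_add h1 h2).trans (le_order_mul _ _))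
    exact_mod_cast hp

omit [Algebra ℚ T] in
theorem le_order_mul_of_le {a b : T⟦X⟧} {m n : ℕ} (ha : (m : ℕ∞) ≤ a.order)
    (hb : (n : ℕ∞) ≤ b.order) : ((m + n : ℕ) : ℕ∞) ≤ (a * b).order := by
  push_cast
  exact (add_le_add ha hb).trans (le_order_mul a b)

omit [Algebra ℚ T] in
theorem le_order_pow_sub_pow {f g : T⟦X⟧} {n : ℕ} (h : (n : ℕ∞) ≤ (f - g).order) (k : ℕ) :
    (n : ℕ∞) ≤ (f ^ k - g ^ k).order := by
  induction k with
  | zero => simp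
  | succ k ih =>
    have e : f ^ (k + 1) - g ^ (k + 1) = f ^ k * (f - g) + (f ^ k - g ^ k) * g := by
      noncomm_ring
    rw [e]
    refine le_trans (le_min ?_ ?_) (min_order_le_order_add _ _)
    · simpa using le_order_mul_of_le (m := 0) (by simp) h
    · simpa using le_order_mul_of_le (n := 0) ih (by simp)

-- Each term of the telescoping identity keeps a further factor without constant term, and this
-- raises the order by one.
omit [Algebra ℚ T] in
theorem le_order_pow_sub_pow_of_two_le {f g : T⟦X⟧} (hf : constantCoeff f = 0)
    (hg : constantCoeff g = 0) {n : ℕ} (h : (n : ℕ∞) ≤ (f - g).order) {k : ℕ} (hk : 2 ≤ k) :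
    ((n + 1 : ℕ) : ℕ∞) ≤ (f ^ k - g ^ k).order := by
  obtain ⟨k, rfl⟩ : ∃ j, k = j + 2 := ⟨k - 2, by omega⟩
  have e : f ^ (k + 2) - g ^ (k + 2) = f ^ (k + 1) * (f - g) + (f ^ (k + 1) - g ^ (k + 1)) * g := by
    noncomm_ring
  rw [e]
  have h1 : ((1 : ℕ) : ℕ∞) ≤ g.order := by
    simpa using le_order_pow_of_constantCoeff_eq_zero 1 hg
  have h2 : ((1 : ℕ) : ℕ∞) ≤ (f ^ (k + 1)).order :=
    le_trans (by exact_mod_cast Nat.le_add_left 1 k)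
      (le_order_pow_of_constantCoeff_eq_zero (k + 1) hf)
  refine le_trans (le_min ?_ ?_) (min_order_le_order_add _ _)
  · rw [add_comm n 1]; exact le_order_mul_of_le h2 h
  · exact le_order_mul_of_le (le_order_pow_sub_pow h _) h1

/-- If `f` and `g` agree up to degree `n`, their powers of exponent at least two agree in degree `n
+ 1`, so the exponentials differ there exactly by the linear terms. This serves as uniqueness of the
logarithm. -/
theorem serExp_injective {f g : T⟦X⟧} (hf : constantCoeff f = 0) (hg : constantCoeff g = 0)
    (h : serExp f = serExp g) : f = g := by
  have key : ∀ n : ℕ, ((n + 1 : ℕ) : ℕ∞) ≤ (f - g).order := by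
    intro n
    induction n with
    | zero =>
      refine nat_le_order _ _ fun i hi => ?_
      obtain rfl : i = 0 := by omega
      simp [hf, hg]
    | succ n ih =>
      refine nat_le_order _ _ fun i hi => ?_
      rcases Nat.lt_succ_iff_lt_or_eq.1 hi with hi | rfl
      · exact coeff_of_lt_order i (lt_of_lt_of_le (by exact_mod_cast hi) ih)
      have h1 : coeff (n + 1) (serExp f - serExp g) = 0 := by rw [h, sub_self, map_zero]
      rw [map_sub, coeff_serExp hf (show n + 1 < n + 1 + 2 by omega),
        coeff_serExp hg (show n + 1 < n + 1 + 2 by omega), ← map_sub, ← sum_sub_distrib,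
        sum_range_succ', sum_range_succ'] at h1
      have h2 : ∀ k ∈ range (n + 1), coeff (n + 1)
          ((((k + 1 + 1).factorial : ℚ)⁻¹) • f ^ (k + 1 + 1) -
            (((k + 1 + 1).factorial : ℚ)⁻¹) • g ^ (k + 1 + 1)) = 0 := by
        intro k _
        rw [← smul_sub, coeff_smul, coeff_of_lt_order (n + 1), smul_zero]
        exact lt_of_lt_of_le (by exact_mod_cast Nat.lt_succ_self _)
          (le_order_pow_sub_pow_of_two_le hf hg ih (by omega))
      rw [map_add, map_add, map_sum, sum_eq_zero h2] at h1
      simpa using h1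
  refine sub_eq_zero.1 (order_eq_top.1 (ENat.eq_top_iff_forall_ge.2 fun m => ?_))
  exact le_trans (by exact_mod_cast Nat.le_succ m) (key m)

omit [Algebra ℚ T] in
theorem C_mul_X_pow (a : T) (k : ℕ) : (C a * X : T⟦X⟧) ^ k = C (a ^ k) * X ^ k := by
  rw [(commute_X (C a)).mul_pow, map_pow]

theorem serExp_C_mul_X (a : T) :
    serExp (C a * X : T⟦X⟧) = mk fun n => ((n.factorial : ℚ)⁻¹) • a ^ n := by
  ext n
  rw [serExp, coeff_mk, coeff_mk, sum_eq_single n]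
  · rw [C_mul_X_pow, coeff_C_mul, coeff_X_pow, if_pos rfl, mul_one]
  · intro k _ hk
    rw [C_mul_X_pow, coeff_C_mul, coeff_X_pow, if_neg hk.symm, mul_zero, smul_zero]
  · simp

/-- For commutative coefficients this gives access to the chain rule for `subst`. -/
theorem serExp_eq_subst {f : ℚ⟦X⟧} (hf : constantCoeff f = 0) :
    serExp f = (PowerSeries.exp ℚ).subst f := by
  ext n
  rw [coeff_subst' (HasSubst.of_constantCoeff_zero' hf), serExp, coeff_mk,
    finsum_eq_sum_of_support_subset (s := range (n + 1))]
  · refine sum_congr rfl fun k _ => ?_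
    simp [coeff_exp]
  · intro k hk
    by_contra h
    refine hk ?_
    simp only [coe_range, Set.mem_Iio, not_lt] at h
    simp only [coeff_pow_eq_zero hf (show n < k by omega), smul_zero]

/-- With `u = log'` and `g = exp ∘ log`, one has `g' = g u` and `u' = -u²`, so `(g u)' = 0` and `g u
= 1` by the constant term. As also `u (1 + X) = 1`, it follows that `g = 1 + X`. -/
theorem serExp_log : serExp (PowerSeries.log ℚ) = 1 + X := by
  rw [serExp_eq_subst constantCoeff_log]
  set g := (PowerSeries.exp ℚ).subst (PowerSeries.log ℚ) with hg
  set u := d⁄dX ℚ (PowerSeries.log ℚ) with hu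
  have hu1 : u * (1 + X) = 1 := by
    rw [hu, deriv_log]
    ext n
    rcases n with _ | n
    · simp [mul_add]
    · simp [mul_add, coeff_succ_mul_X, coeff_one, pow_succ]
  have hg' : d⁄dX ℚ g = g * u := by
    rw [hg, derivative_subst HasSubst.log, derivative_exp]
  have hu' : d⁄dX ℚ u = - (u * u) := by
    have := congrArg (d⁄dX ℚ) hu1
    rw [Derivation.leibniz, map_add, derivative_X, ← map_one (C (R := ℚ)), derivative_C] at this
    simp only [smul_eq_mul, map_one] at this
    linear_combination u * this - d⁄dX ℚ u * hu1
  have h1 : g * u = 1 := by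
    refine derivative.ext ?_ ?_
    · rw [Derivation.leibniz, hg', hu', derivative_one]
      simp only [smul_eq_mul]
      ring
    · have e : constantCoeff g = 1 := by
        rw [hg, ← serExp_eq_subst constantCoeff_log, ← coeff_zero_eq_constantCoeff_apply, serExp,
          coeff_mk]
        simp
      rw [map_mul, e, hu, deriv_log]
      simp
  linear_combination (1 + X) * h1 - g * hu1

/-- `exp (log (1 + z)) = 1 + z`. -/
theorem serExp_serLog {z : T⟦X⟧} (hz : constantCoeff z = 0) : serExp (serLog z) = 1 + z := by
  ext n
  -- Degree `n` sees only finitely many terms, so the one-variable identity can be carried over by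
  -- polynomials: with `p` the truncated logarithm, the error `q` is divisible by `X ^ (n + 1)`, and
  -- substituting `z` for `X` makes it invisible in degree `n`.
  set p : Polynomial ℚ :=
    ∑ k ∈ range (n + 1), ((-1) ^ (k + 1) / (k : ℚ)) • Polynomial.X ^ k with hp
  set q : Polynomial ℚ :=
    (∑ k ∈ range (n + 1), ((k.factorial : ℚ)⁻¹) • p ^ k) - (1 + Polynomial.X) with hq
  have hlog : ((n + 1 : ℕ) : ℕ∞) ≤ ((p : ℚ⟦X⟧) - PowerSeries.log ℚ).order := by
    refine nat_le_order _ _ fun i hi => ?_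
    rw [map_sub, Polynomial.coeff_coe, hp, coeff_log, Polynomial.finsetSum_coeff]
    simp only [Polynomial.coeff_smul, Polynomial.coeff_X_pow, smul_eq_mul, mul_ite, mul_one,
      mul_zero]
    rw [sum_ite_eq, if_pos (by simpa using hi)]
    split_ifs with h0 <;> simp [h0]
  have hdvd : Polynomial.X ^ (n + 1) ∣ q := by
    rw [Polynomial.X_pow_dvd_iff]
    intro d hd
    have h1 : coeff d (serExp (PowerSeries.log ℚ) - (1 + X)) = 0 := by
      rw [serExp_log, sub_self, map_zero]
    rw [map_sub, coeff_serExp constantCoeff_log hd] at h1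
    have h2 : coeff d (∑ k ∈ range (n + 1), ((k.factorial : ℚ)⁻¹) • (p : ℚ⟦X⟧) ^ k) =
        coeff d (∑ k ∈ range (n + 1), ((k.factorial : ℚ)⁻¹) • (PowerSeries.log ℚ) ^ k) := by
      rw [map_sum, map_sum]
      refine sum_congr rfl fun k _ => ?_
      rw [coeff_smul, coeff_smul]
      congr 1
      rw [← sub_eq_zero, ← map_sub]
      exact coeff_of_lt_order d
        (lt_of_lt_of_le (by exact_mod_cast hd) (le_order_pow_sub_pow hlog k))
    rw [← h2, ← map_sub] at h1
    rw [← Polynomial.coeff_coe, ← h1]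
    congr 1
    rw [hq, ← Polynomial.coeToPowerSeries.ringHom_apply]
    simp only [Polynomial.smul_eq_C_mul, PowerSeries.smul_eq_C_mul, map_sub, map_sum, map_mul,
      map_pow, map_add, map_one, Polynomial.coeToPowerSeries.ringHom_apply, Polynomial.coe_C,
      Polynomial.coe_X]
  obtain ⟨r, hr⟩ := hdvd
  have hz1 : ((1 : ℕ) : ℕ∞) ≤ z.order := by
    simpa using le_order_pow_of_constantCoeff_eq_zero 1 hz
  have hpz : ((n + 1 : ℕ) : ℕ∞) ≤ (serLog z - Polynomial.aeval z p).order := by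
    refine nat_le_order _ _ fun i hi => ?_
    rw [map_sub, coeff_serLog hz hi, hp]
    simp
  have hqz : coeff n (Polynomial.aeval z q) = 0 := by
    rw [hr, map_mul, map_pow, Polynomial.aeval_X]
    refine coeff_of_lt_order n (lt_of_lt_of_le (b := ((n + 1 + 0 : ℕ) : ℕ∞)) ?_
      (le_order_mul_of_le (le_order_pow_of_constantCoeff_eq_zero (n + 1) hz) (by simp)))
    exact_mod_cast Nat.lt_succ_self n
  rw [hq, map_sub, map_sub, sub_eq_zero] at hqz
  rw [coeff_serExp (constantCoeff_serLog z) (Nat.lt_succ_self n)]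
  simp only [map_add, map_one, Polynomial.aeval_X, map_sum, map_smul, map_pow] at hqz ⊢
  rw [← hqz]
  refine sum_congr rfl fun k _ => ?_
  rw [coeff_smul, coeff_smul]
  congr 1
  rw [← sub_eq_zero, ← map_sub]
  exact coeff_of_lt_order n (lt_of_lt_of_le (by exact_mod_cast Nat.lt_succ_self n)
    (le_order_pow_sub_pow hpz k))

end SeriesExp

/-! ### The series `log (exp x * exp y)` -/

section Words

open PowerSeries Finset

/-- The word `w` as a noncommutative polynomial. -/
def word (w : List (Fin 2)) : NCPoly := MonoidAlgebra.of ℚ _ (FreeMonoid.ofList w)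

theorem word_nil : word [] = 1 := map_one (MonoidAlgebra.of ℚ _)

theorem word_append (v w : List (Fin 2)) : word (v ++ w) = word v * word w := by
  rw [word, FreeMonoid.ofList_append, map_mul]; rfl

theorem word_cons (i : Fin 2) (w : List (Fin 2)) : word (i :: w) = word [i] * word w :=
  word_append [i] w

/-- Two linear maps on noncommutative polynomials agree when they agree on words. -/
theorem linearMap_ext_word {V : Type*} [AddCommGroup V] [Module ℚ V] {f g : NCPoly →ₗ[ℚ] V}
    (h : ∀ w, f (word w) = g (word w)) : f = g := by
  ext w
  simpa [word] using h (FreeMonoid.toList w)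

/-- The linear map with prescribed values on words. -/
def wordLift {V : Type*} [AddCommGroup V] [Module ℚ V] (c : List (Fin 2) → V) :
    NCPoly →ₗ[ℚ] V :=
  Finsupp.lsum ℚ (fun w => LinearMap.toSpanSingleton ℚ V (c (FreeMonoid.toList w))) ∘ₗ
    (MonoidAlgebra.coeffLinearEquiv ℚ).toLinearMap

theorem wordLift_word {V : Type*} [AddCommGroup V] [Module ℚ V] (c : List (Fin 2) → V)
    (w : List (Fin 2)) : wordLift c (word w) = c w := by
  simp [wordLift, word]

/-- Noncommutative polynomials that are homogeneous of degree `n`. -/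
def homog (n : ℕ) : Submodule ℚ NCPoly := Submodule.span ℚ {p | ∃ w, w.length = n ∧ p = word w}

theorem word_mem_homog (w : List (Fin 2)) : word w ∈ homog w.length :=
  Submodule.subset_span ⟨w, rfl, rfl⟩

theorem one_mem_homog : (1 : NCPoly) ∈ homog 0 := by
  simpa [word_nil] using word_mem_homog []

theorem mul_mem_homog {m n : ℕ} {p q : NCPoly} (hp : p ∈ homog m) (hq : q ∈ homog n) :
    p * q ∈ homog (m + n) := by
  have h := Submodule.mul_mem_mul hp hq
  rw [homog, homog, Submodule.span_mul_span] at h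
  refine Submodule.span_mono ?_ h
  rintro _ ⟨_, ⟨v, rfl, rfl⟩, _, ⟨w, rfl, rfl⟩, rfl⟩
  exact ⟨v ++ w, by simp, (word_append v w).symm⟩

theorem eq_sum_of_mem_homog {n : ℕ} {p : NCPoly} (hp : p ∈ homog n) :
    p = ∑ w : Fin n → Fin 2, p.coeff (FreeMonoid.ofList (List.ofFn w)) • word (List.ofFn w) := by
  let f : NCPoly →ₗ[ℚ] NCPoly := ∑ w : Fin n → Fin 2,
    ((LinearMap.toSpanSingleton ℚ NCPoly (word (List.ofFn w))) ∘ₗ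
      Finsupp.lapply (FreeMonoid.ofList (List.ofFn w))) ∘ₗ
      (MonoidAlgebra.coeffLinearEquiv ℚ).toLinearMap
  have hf : ∀ q, f q =
      ∑ w : Fin n → Fin 2, q.coeff (FreeMonoid.ofList (List.ofFn w)) • word (List.ofFn w) := by
    intro q
    simp [f]
  have : homog n ≤ LinearMap.eqLocus LinearMap.id f := by
    refine Submodule.span_le.2 ?_
    rintro _ ⟨v, rfl, rfl⟩
    change word v = f (word v)
    rw [hf, Finset.sum_eq_single v.get]
    · rw [List.ofFn_get]; simp [word]
    · intro w _ hw
      rw [word, MonoidAlgebra.of_apply, MonoidAlgebra.coeff_single, Finsupp.single_eq_of_ne,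
        zero_smul]
      intro h
      apply hw
      have h' : List.ofFn w = List.ofFn v.get := by
        rw [List.ofFn_get]; exact FreeMonoid.ofList.injective h
      exact List.ofFn_injective h'
    · simp
  rw [← hf]
  exact this hp

/-- Power series whose coefficient of degree `n` is homogeneous of degree `n`. -/
def homogSeries : Subalgebra ℚ NCPoly⟦X⟧ where
  carrier := {f | ∀ n, coeff n f ∈ homog n}
  mul_mem' := by
    intro f g hf hg n
    rw [coeff_mul]
    refine Submodule.sum_mem _ fun p hp => ?_
    rw [HasAntidiagonal.mem_antidiagonal] at hp
    rw [← hp]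
    exact mul_mem_homog (hf _) (hg _)
  add_mem' := by
    intro f g hf hg n
    rw [map_add]
    exact Submodule.add_mem _ (hf n) (hg n)
  algebraMap_mem' := by
    intro r n
    rw [Algebra.algebraMap_eq_smul_one, coeff_smul, coeff_one]
    split_ifs with h
    · rw [h]; exact Submodule.smul_mem _ _ one_mem_homog
    · simp

/-- The letter `i`. -/
abbrev letter (i : Fin 2) : NCPoly := word [i]

theorem letter_pow_mem_homog (i : Fin 2) (n : ℕ) : letter i ^ n ∈ homog n := by
  induction n with
  | zero => simpa using one_mem_homog
  | succ n ih => rw [pow_succ]; exact mul_mem_homog ih (word_mem_homog [i])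

theorem expLetter_eq (i : Fin 2) : expLetter i = serExp (C (letter i) * X) := by
  rw [serExp_C_mul_X]; rfl

theorem expLetter_mem (i : Fin 2) : expLetter i ∈ homogSeries := by
  intro n
  rw [expLetter, coeff_mk]
  exact Submodule.smul_mem _ _ (letter_pow_mem_homog i n)

theorem constantCoeff_expLetter (i : Fin 2) : constantCoeff (expLetter i) = 1 := by
  rw [← coeff_zero_eq_constantCoeff_apply, expLetter, coeff_mk]; simp

/-- The series `log (exp x * exp y)`. -/
def bchSeries : NCPoly⟦X⟧ := serLog (expLetter 0 * expLetter 1 - 1)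

theorem constantCoeff_bchSeries : constantCoeff bchSeries = 0 := constantCoeff_serLog _

theorem serExp_bchSeries : serExp bchSeries = expLetter 0 * expLetter 1 := by
  rw [bchSeries, serExp_serLog (by simp [constantCoeff_expLetter])]
  abel

theorem bchSeries_mem : bchSeries ∈ homogSeries := by
  intro n
  rw [bchSeries, serLog, coeff_mk]
  refine Submodule.sum_mem _ fun k _ => Submodule.smul_mem _ _ ?_
  exact Subalgebra.pow_mem _ (Subalgebra.sub_mem _
    (Subalgebra.mul_mem _ (expLetter_mem 0) (expLetter_mem 1)) (Subalgebra.one_mem _)) k n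

/-- Homogeneity ensures that the words of length `n` account for the whole coefficient; this links
the scalars `bchCoeff` to the series identities. -/
theorem coeff_bchSeries (n : ℕ) :
    coeff n bchSeries = ∑ w : Fin n → Fin 2, bchCoeff (List.ofFn w) • word (List.ofFn w) := by
  rw [eq_sum_of_mem_homog (bchSeries_mem n)]
  refine sum_congr rfl fun w _ => ?_
  congr 1
  rw [bchSeries, serLog, coeff_mk, bchCoeff]
  simp

theorem coeff_one_bchSeries : coeff 1 bchSeries = letter 0 + letter 1 := by
  rw [bchSeries, serLog, coeff_mk]
  simp [coeff_mul, Nat.antidiagonal_succ, expLetter, coeff_one, word, add_comm]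

theorem coeff_letter_of_ne {i j : Fin 2} (h : i ≠ j) :
    (letter j).coeff (FreeMonoid.ofList [i]) = 0 :=
  Finsupp.single_eq_of_ne fun h' => h (by simpa using FreeMonoid.ofList.injective h')

theorem coeff_letter_self (i : Fin 2) : (letter i).coeff (FreeMonoid.ofList [i]) = 1 :=
  Finsupp.single_eq_same

/-- This makes the linear part of `C(u, v)` equal to `u + v`, so that `bch` starts in degree two. -/
theorem bchCoeff_singleton (i : Fin 2) : bchCoeff [i] = 1 := by
  have h : bchCoeff [i] = (coeff 1 bchSeries).coeff (FreeMonoid.ofList [i]) := by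
    rw [bchSeries, serLog, coeff_mk, bchCoeff]
    simp
  rw [h, coeff_one_bchSeries, MonoidAlgebra.coeff_add, Finsupp.add_apply]
  fin_cases i
  · exact (congrArg₂ _ (coeff_letter_self 0) (coeff_letter_of_ne (by decide))).trans (add_zero 1)
  · exact (congrArg₂ _ (coeff_letter_of_ne (by decide)) (coeff_letter_self 1)).trans (zero_add 1)

end Words

/-! ### Dynkin's operator -/

section Dynkin

open PowerSeries TensorProduct

/-- Dynkin's operator: a word goes to the right-nested commutator of its letters. -/
def dynkin : NCPoly →ₗ[ℚ] NCPoly := wordLift (wordEval (fun a b => ⁅a, b⁆) letter)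

/-- The Euler operator: multiplication of words by their length. -/
def euler : NCPoly →ₗ[ℚ] NCPoly := wordLift fun w => (w.length : ℚ) • word w

/-- The constant term. -/
def augmentation : NCPoly →ₗ[ℚ] ℚ := wordLift fun w => if w = [] then 1 else 0

/-- The coproduct for which the letters are primitive. -/
def coproduct : NCPoly →ₐ[ℚ] NCPoly ⊗[ℚ] NCPoly :=
  MonoidAlgebra.lift ℚ _ _ (FreeMonoid.lift fun i => letter i ⊗ₜ 1 + 1 ⊗ₜ letter i)

theorem coproduct_letter (i : Fin 2) :
    coproduct (letter i) = letter i ⊗ₜ 1 + 1 ⊗ₜ letter i := by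
  simp [coproduct, word, -MonoidAlgebra.of_apply, MonoidAlgebra.lift_of]

theorem letter_mul_eq_mulLeft_word (i : Fin 2) (w : List (Fin 2)) :
    LinearMap.mulLeft ℚ (letter i) (word w) = word (i :: w) := (word_cons i w).symm

/-- On nonempty words this is the defining commutator. The augmentation term corrects the empty
word, where the commutator vanishes but a single letter is fixed by Dynkin's operator. -/
theorem dynkin_letter_mul (i : Fin 2) (p : NCPoly) :
    dynkin (letter i * p) =
      letter i * dynkin p - dynkin p * letter i + augmentation p • letter i := by
  have : dynkin ∘ₗ LinearMap.mulLeft ℚ (letter i) =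
      LinearMap.mulLeft ℚ (letter i) ∘ₗ dynkin - LinearMap.mulRight ℚ (letter i) ∘ₗ dynkin +
        LinearMap.toSpanSingleton ℚ NCPoly (letter i) ∘ₗ augmentation := by
    refine linearMap_ext_word fun w => ?_
    rw [LinearMap.comp_apply, letter_mul_eq_mulLeft_word]
    simp only [LinearMap.add_apply, LinearMap.sub_apply, LinearMap.comp_apply, dynkin,
      augmentation, wordLift_word, LinearMap.mulLeft_apply, LinearMap.mulRight_apply,
      LinearMap.toSpanSingleton_apply]
    rcases w with _ | ⟨j, w⟩
    · simp [wordEval]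
    · simp [wordEval, Ring.lie_def]
  exact LinearMap.congr_fun this p

theorem augmentation_letter_mul (i : Fin 2) (p : NCPoly) : augmentation (letter i * p) = 0 := by
  have : augmentation ∘ₗ LinearMap.mulLeft ℚ (letter i) = 0 := by
    refine linearMap_ext_word fun w => ?_
    rw [LinearMap.comp_apply, letter_mul_eq_mulLeft_word]
    simp [augmentation, wordLift_word]
  exact LinearMap.congr_fun this p

/-- The convolution of Dynkin's operator with the identity. -/
def dynkinConv : NCPoly ⊗[ℚ] NCPoly →ₗ[ℚ] NCPoly :=
  LinearMap.mul' ℚ NCPoly ∘ₗ TensorProduct.map dynkin LinearMap.id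

/-- Contraction of the left factor by the constant term. -/
def augmentLeft : NCPoly ⊗[ℚ] NCPoly →ₗ[ℚ] NCPoly :=
  (TensorProduct.lid ℚ NCPoly).toLinearMap ∘ₗ TensorProduct.map augmentation LinearMap.id

theorem augmentLeft_letter_mul (i : Fin 2) (t : NCPoly ⊗[ℚ] NCPoly) :
    augmentLeft ((letter i ⊗ₜ 1 + 1 ⊗ₜ letter i) * t) = letter i * augmentLeft t := by
  induction t using TensorProduct.induction_on with
  | zero => simp
  | add a b ha hb => rw [mul_add, map_add, ha, hb, map_add, mul_add]
  | tmul p q => simp [augmentLeft, add_mul, augmentation_letter_mul]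

/-- On `p ⊗ q` the term `-(dynkin p) * letter i * q` from the commutator cancels against the
contribution of `1 ⊗ letter i`. -/
theorem dynkinConv_letter_mul (i : Fin 2) (t : NCPoly ⊗[ℚ] NCPoly) :
    dynkinConv ((letter i ⊗ₜ 1 + 1 ⊗ₜ letter i) * t) =
      letter i * dynkinConv t + letter i * augmentLeft t := by
  induction t using TensorProduct.induction_on with
  | zero => simp
  | add a b ha hb => simp only [mul_add, map_add, ha, hb]; abel
  | tmul p q =>
    simp [dynkinConv, augmentLeft, add_mul, sub_mul, dynkin_letter_mul, mul_assoc]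
    abel

theorem augmentLeft_coproduct_word (w : List (Fin 2)) :
    augmentLeft (coproduct (word w)) = word w := by
  induction w with
  | nil =>
    rw [word_nil, map_one, Algebra.TensorProduct.one_def, ← word_nil]
    simp [augmentLeft, augmentation, wordLift_word]
  | cons i w ih => rw [word_cons, map_mul, coproduct_letter, augmentLeft_letter_mul, ih]

/-- By induction on words: the augmentation contracts the coproduct of `w` back to `w`, so each
added letter contributes exactly one more copy of the word. -/
theorem dynkinConv_coproduct (p : NCPoly) : dynkinConv (coproduct p) = euler p := by
  have : dynkinConv ∘ₗ coproduct.toLinearMap = euler := by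
    refine linearMap_ext_word fun w => ?_
    simp only [LinearMap.comp_apply, AlgHom.toLinearMap_apply, euler, wordLift_word]
    induction w with
    | nil =>
      rw [word_nil, map_one, Algebra.TensorProduct.one_def, ← word_nil]
      simp [dynkinConv, dynkin, wordLift_word, wordEval]
    | cons i w ih =>
      rw [word_cons, map_mul, coproduct_letter, dynkinConv_letter_mul, ih,
        augmentLeft_coproduct_word, mul_smul_comm, List.length_cons, Nat.cast_add, add_smul,
        Nat.cast_one, one_smul]
  exact LinearMap.congr_fun this p

theorem euler_of_mem_homog {n : ℕ} {p : NCPoly} (hp : p ∈ homog n) : euler p = (n : ℚ) • p := by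
  have : homog n ≤ LinearMap.eqLocus euler ((n : ℚ) • LinearMap.id) := by
    refine Submodule.span_le.2 ?_
    rintro _ ⟨v, rfl, rfl⟩
    simp [euler, wordLift_word]
  exact this hp

/-- The embedding of the left tensor factor. -/
abbrev inclL : NCPoly →ₐ[ℚ] NCPoly ⊗[ℚ] NCPoly := Algebra.TensorProduct.includeLeft

/-- The embedding of the right tensor factor. -/
abbrev inclR : NCPoly →ₐ[ℚ] NCPoly ⊗[ℚ] NCPoly := Algebra.TensorProduct.includeRight

theorem commute_map_inclL_inclR (f g : NCPoly⟦X⟧) :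
    Commute (PowerSeries.map (inclL : NCPoly →+* NCPoly ⊗[ℚ] NCPoly) f)
      (PowerSeries.map (inclR : NCPoly →+* NCPoly ⊗[ℚ] NCPoly) g) := by
  ext n
  rw [coeff_mul, coeff_mul, ← Finset.Nat.sum_antidiagonal_swap]
  refine Finset.sum_congr rfl fun p _ => ?_
  simp

/-- The exponential of a primitive element is group-like: its two tensor parts commute, so
`serExp_add` applies. -/
theorem map_coproduct_expLetter (i : Fin 2) :
    PowerSeries.map (coproduct : NCPoly →+* NCPoly ⊗[ℚ] NCPoly) (expLetter i) =
      PowerSeries.map (inclL : NCPoly →+* NCPoly ⊗[ℚ] NCPoly) (expLetter i) *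
        PowerSeries.map (inclR : NCPoly →+* NCPoly ⊗[ℚ] NCPoly) (expLetter i) := by
  rw [expLetter_eq, map_serExp, map_serExp, map_serExp, ← serExp_add _ _
    (commute_map_inclL_inclR _ _)]
  · congr 1
    simp only [map_mul, PowerSeries.map_C, PowerSeries.map_X, ← add_mul]
    rw [← map_add]
    congr 2
    exact coproduct_letter i
  · simp
  · simp

/-- The components of `log (exp x * exp y)` are primitive. -/
theorem map_coproduct_bchSeries :
    PowerSeries.map (coproduct : NCPoly →+* NCPoly ⊗[ℚ] NCPoly) bchSeries =
      PowerSeries.map (inclL : NCPoly →+* NCPoly ⊗[ℚ] NCPoly) bchSeries +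
        PowerSeries.map (inclR : NCPoly →+* NCPoly ⊗[ℚ] NCPoly) bchSeries := by
  have h0 : ∀ φ : NCPoly →ₐ[ℚ] NCPoly ⊗[ℚ] NCPoly,
      constantCoeff (PowerSeries.map (φ : NCPoly →+* NCPoly ⊗[ℚ] NCPoly) bchSeries) = 0 := by
    intro φ
    rw [← coeff_zero_eq_constantCoeff_apply, coeff_map, coeff_zero_eq_constantCoeff_apply,
      constantCoeff_bchSeries, map_zero]
  -- It suffices to compare exponentials. Both sides become the same four factors once the middle
  -- two, from different tensor factors, are exchanged.
  refine serExp_injective (h0 _) (by rw [map_add, h0, h0, add_zero]) ?_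
  rw [serExp_add (h0 _) (h0 _) (commute_map_inclL_inclR _ _), ← map_serExp, ← map_serExp,
    ← map_serExp, serExp_bchSeries, map_mul, map_mul, map_mul, map_coproduct_expLetter,
    map_coproduct_expLetter]
  simp only [mul_assoc]
  congr 1
  rw [← mul_assoc, ← mul_assoc, (commute_map_inclL_inclR _ _).eq]

/-- The components of `log (exp x * exp y)` are Lie polynomials, in the form of Dynkin's
criterion. -/
theorem dynkin_coeff_bchSeries (n : ℕ) :
    dynkin (coeff n bchSeries) = (n : ℚ) • coeff n bchSeries := by
  rw [← euler_of_mem_homog (bchSeries_mem n), ← dynkinConv_coproduct]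
  have h := congrArg (coeff n) map_coproduct_bchSeries
  rw [map_add, coeff_map, coeff_map, coeff_map] at h
  change coproduct _ = (coeff n bchSeries) ⊗ₜ 1 + 1 ⊗ₜ (coeff n bchSeries) at h
  -- On `p ⊗ 1 + 1 ⊗ p` the convolution gives `dynkin p + dynkin 1 * p`, whose second term vanishes.
  have h1 : dynkin 1 = 0 := by rw [← word_nil, dynkin, wordLift_word, wordEval]
  rw [h]
  simp [dynkinConv, h1]

end Dynkin

/-! ### Evaluation of noncommutative polynomials -/

section Eval

open Finset

variable {K E : Type*} [Field K] [CharZero K] [Ring E] [Algebra K E]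

omit [CharZero K] in
theorem commute_algebraMap_comp {R : Type*} [Semiring R] (φ : R →+* K) (r : R) (x : E) :
    Commute ((algebraMap K E).comp φ r) x :=
  Algebra.commutes (φ r) x

/-- Evaluation of noncommutative polynomials at `f 0`, `f 1`. -/
def ncEval (K : Type*) {E : Type*} [Field K] [CharZero K] [Ring E] [Algebra K E]
    (f : Fin 2 → E) : NCPoly →+* E :=
  MonoidAlgebra.liftNCRingHom ((algebraMap K E).comp (Rat.castHom K)) (FreeMonoid.lift f)
    fun _ _ => commute_algebraMap_comp _ _ _

theorem ncEval_word (f : Fin 2 → E) (w : List (Fin 2)) :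
    ncEval K f (word w) = (w.map f).prod := by
  rw [ncEval, word, MonoidAlgebra.of_apply, MonoidAlgebra.liftNCRingHom_single, map_one, one_mul,
    FreeMonoid.lift_apply, FreeMonoid.toList_ofList]

theorem ncEval_algebraMap (f : Fin 2 → E) (q : ℚ) :
    ncEval K f (algebraMap ℚ NCPoly q) = algebraMap K E (q : K) := by
  rw [ncEval, MonoidAlgebra.coe_algebraMap, Function.comp_apply,
    MonoidAlgebra.liftNCRingHom_single, map_one, mul_one]
  rfl

theorem ncEval_smul (f : Fin 2 → E) (q : ℚ) (p : NCPoly) :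
    ncEval K f (q • p) = (q : K) • ncEval K f p := by
  rw [Algebra.smul_def, map_mul, ncEval_algebraMap, ← Algebra.smul_def]

theorem ncEval_mem_of_mem_homog {f : Fin 2 → E} {G : Submodule K E} {n : ℕ}
    (hG : ∀ w : List (Fin 2), w.length = n → (w.map f).prod ∈ G) {p : NCPoly} (hp : p ∈ homog n) :
    ncEval K f p ∈ G := by
  induction hp using Submodule.span_induction with
  | mem p h => obtain ⟨w, hw, rfl⟩ := h; rw [ncEval_word]; exact hG w hw
  | zero => rw [map_zero]; exact G.zero_mem
  | add p q _ _ hp hq => rw [map_add]; exact G.add_mem hp hq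
  | smul r p _ hp => rw [ncEval_smul]; exact G.smul_mem _ hp

/-- Partial sums of the exponential series over a ring of noncommutative coefficients. -/
def polyExp {R : Type*} [Ring R] [Algebra ℚ R] (N : ℕ) (p : Polynomial R) : Polynomial R :=
  ∑ k ∈ range N, Polynomial.C (algebraMap ℚ R (k.factorial : ℚ)⁻¹) * p ^ k

theorem coe_polyExp {R : Type*} [Ring R] [Algebra ℚ R] (N : ℕ) (p : Polynomial R) :
    (polyExp N p : R⟦X⟧) = ∑ k ∈ range N, ((k.factorial : ℚ)⁻¹) • (p : R⟦X⟧) ^ k := by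
  rw [polyExp, ← Polynomial.coeToPowerSeries.ringHom_apply, map_sum]
  refine sum_congr rfl fun k _ => ?_
  rw [map_mul, map_pow, Polynomial.coeToPowerSeries.ringHom_apply,
    Polynomial.coeToPowerSeries.ringHom_apply, Polynomial.coe_C, Algebra.smul_def,
    PowerSeries.algebraMap_apply]

/-- Below degree `N` the exponential stops before its `N`-th term, and taking powers preserves
agreement below degree `N`. -/
theorem le_order_polyExp_sub_serExp {R : Type*} [Ring R] [Algebra ℚ R] {N : ℕ} {p : Polynomial R}
    {f : R⟦X⟧} (hf : PowerSeries.constantCoeff f = 0) (h : (N : ℕ∞) ≤ ((p : R⟦X⟧) - f).order) :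
    (N : ℕ∞) ≤ ((polyExp N p : R⟦X⟧) - serExp f).order := by
  refine PowerSeries.nat_le_order _ _ fun i hi => ?_
  rw [map_sub, coeff_serExp hf hi, coe_polyExp, map_sum, map_sum, ← sum_sub_distrib]
  refine sum_eq_zero fun k _ => ?_
  rw [← map_sub, ← smul_sub, PowerSeries.coeff_smul, PowerSeries.coeff_of_lt_order i, smul_zero]
  exact lt_of_lt_of_le (by exact_mod_cast hi) (le_order_pow_sub_pow h k)

theorem polyExp_mem_homogSeries {N : ℕ} {p : Polynomial NCPoly}
    (hp : (p : NCPoly⟦X⟧) ∈ homogSeries) : (polyExp N p : NCPoly⟦X⟧) ∈ homogSeries := by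
  rw [coe_polyExp]
  exact Subalgebra.sum_mem _ fun k _ => Subalgebra.smul_mem _ (Subalgebra.pow_mem _ hp k) _

/-- Evaluation at `X = 1` after evaluation of the coefficients. -/
def polyEval (φ : NCPoly →+* E) : Polynomial NCPoly →+* E :=
  Polynomial.eval₂RingHom' φ 1 fun _ => Commute.one_right _

omit [Field K] [CharZero K] [Algebra K E] in
theorem polyEval_apply (φ : NCPoly →+* E) (p : Polynomial NCPoly) :
    polyEval φ p = Polynomial.eval₂ φ 1 p := rfl

theorem polyEval_polyExp (f : Fin 2 → E) (N : ℕ) (p : Polynomial NCPoly) :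
    polyEval (ncEval K f) (polyExp N p) = expPartial K (polyEval (ncEval K f) p) N := by
  rw [polyExp, expPartial, map_sum]
  refine sum_congr rfl fun k _ => ?_
  rw [map_mul, map_pow, polyEval_apply (p := Polynomial.C _), Polynomial.eval₂_C,
    ncEval_algebraMap, Algebra.smul_def]
  simp

/-- The identity `exp x * exp y = exp (log (exp x * exp y))`, truncated and evaluated. -/
theorem expPartial_mul_expPartial_sub_mem {f : Fin 2 → E} {G : Submodule K E} {N : ℕ}
    (hG : ∀ w : List (Fin 2), N ≤ w.length → (w.map f).prod ∈ G) :
    expPartial K (f 0) N * expPartial K (f 1) N -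
      expPartial K (ncEval K f (∑ n ∈ range N, PowerSeries.coeff n bchSeries)) N ∈ G := by
  -- A power series in `t` cannot be evaluated at `t = 1`, a polynomial can. The error `q` below has
  -- homogeneous coefficients that vanish in degrees below `N`, so its value is a combination of
  -- words of length at least `N`.
  let x : Fin 2 → Polynomial NCPoly := fun i => Polynomial.C (letter i) * Polynomial.X
  let p : Polynomial NCPoly := ∑ n ∈ range N, Polynomial.monomial n (PowerSeries.coeff n bchSeries)
  have hx : ∀ i, ((x i : Polynomial NCPoly) : NCPoly⟦X⟧) =
      PowerSeries.C (letter i) * PowerSeries.X := by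
    intro i
    simp [x]
  have hp : ∀ i, PowerSeries.coeff i (p : NCPoly⟦X⟧) =
      if i < N then PowerSeries.coeff i bchSeries else 0 := by
    intro i
    rw [Polynomial.coeff_coe, Polynomial.finsetSum_coeff]
    simp [Polynomial.coeff_monomial]
  let q : Polynomial NCPoly := polyExp N (x 0) * polyExp N (x 1) - polyExp N p
  have hqe : (q : NCPoly⟦X⟧) = (polyExp N (x 0) : NCPoly⟦X⟧) * (polyExp N (x 1) : NCPoly⟦X⟧) -
      (polyExp N p : NCPoly⟦X⟧) := by
    simp only [q, ← Polynomial.coeToPowerSeries.ringHom_apply, map_sub, map_mul]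
  have hq : (q : NCPoly⟦X⟧) ∈ homogSeries := by
    have h1 : ∀ i, ((x i : Polynomial NCPoly) : NCPoly⟦X⟧) ∈ homogSeries := by
      intro i n
      rw [hx, ← pow_one (PowerSeries.X), PowerSeries.coeff_C_mul, PowerSeries.coeff_X_pow]
      split_ifs with h
      · rw [mul_one, h]; exact word_mem_homog [i]
      · rw [mul_zero]; exact Submodule.zero_mem _
    have h2 : (p : NCPoly⟦X⟧) ∈ homogSeries := by
      intro n
      rw [hp]
      split_ifs
      · exact bchSeries_mem n
      · exact Submodule.zero_mem _
    rw [hqe]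
    exact Subalgebra.sub_mem _ (Subalgebra.mul_mem _ (polyExp_mem_homogSeries (h1 0))
      (polyExp_mem_homogSeries (h1 1))) (polyExp_mem_homogSeries h2)
  have hq0 : ∀ n < N, q.coeff n = 0 := by
    intro n hn
    have hL : ∀ i, (N : ℕ∞) ≤ ((polyExp N (x i) : NCPoly⟦X⟧) - expLetter i).order := by
      intro i
      rw [expLetter_eq]
      refine le_order_polyExp_sub_serExp (by simp) ?_
      rw [hx, sub_self, PowerSeries.order_zero]
      exact le_top
    have hP : (N : ℕ∞) ≤ ((polyExp N p : NCPoly⟦X⟧) - serExp bchSeries).order := by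
      refine le_order_polyExp_sub_serExp constantCoeff_bchSeries ?_
      refine PowerSeries.nat_le_order _ _ fun i hi => ?_
      rw [map_sub, hp, if_pos hi, sub_self]
    rw [← Polynomial.coeff_coe, hqe]
    have e : (polyExp N (x 0) : NCPoly⟦X⟧) * (polyExp N (x 1) : NCPoly⟦X⟧) -
        (polyExp N p : NCPoly⟦X⟧) =
        (polyExp N (x 0) : NCPoly⟦X⟧) * ((polyExp N (x 1) : NCPoly⟦X⟧) - expLetter 1) +
          ((polyExp N (x 0) : NCPoly⟦X⟧) - expLetter 0) * expLetter 1 -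
            ((polyExp N p : NCPoly⟦X⟧) - serExp bchSeries) := by
      rw [serExp_bchSeries]; noncomm_ring
    have h0 : ∀ g : NCPoly⟦X⟧, (N : ℕ∞) ≤ g.order → PowerSeries.coeff n g = 0 := fun g hg =>
      PowerSeries.coeff_of_lt_order n (lt_of_lt_of_le (by exact_mod_cast hn) hg)
    rw [e, map_sub, map_add, h0 _ hP, h0 _ ?_, h0 _ ?_]
    · simp
    · simpa using le_order_mul_of_le (n := 0) (hL 0) (by simp)
    · simpa using le_order_mul_of_le (m := 0) (by simp) (hL 1)
  have hxe : ∀ i, polyEval (ncEval K f) (x i) = f i := by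
    intro i
    rw [polyEval_apply]
    simp [x, ncEval_word]
  have hpe : polyEval (ncEval K f) p =
      ncEval K f (∑ n ∈ range N, PowerSeries.coeff n bchSeries) := by
    rw [map_sum, map_sum]
    refine sum_congr rfl fun n _ => ?_
    rw [polyEval_apply, Polynomial.eval₂_monomial, one_pow, mul_one]
  rw [← hxe 0, ← hxe 1, ← hpe, ← polyEval_polyExp, ← polyEval_polyExp, ← polyEval_polyExp,
    ← map_mul, ← map_sub]
  change polyEval (ncEval K f) q ∈ G
  rw [polyEval_apply, Polynomial.eval₂_eq_sum, Polynomial.sum]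
  refine Submodule.sum_mem _ fun n _ => ?_
  rw [one_pow, mul_one]
  rcases lt_or_ge n N with h | h
  · rw [hq0 n h, map_zero]; exact G.zero_mem
  · refine ncEval_mem_of_mem_homog (n := n) (fun w hw => hG w (hw ▸ h)) ?_
    rw [← Polynomial.coeff_coe]
    exact hq n

end Eval

/-! ### Limits -/

section Limits

variable {K M : Type*} [Ring K] [AddCommGroup M] [Module K M] {F : ℕ → Submodule K M}

/-- Uniqueness of limits is not needed: the value chosen by `limit` is itself a limit. -/
theorem Converges.limit {u : ℕ → M} {l : M} (h : Converges F u l) :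
    Converges F u (limit F u) := by
  have h' : ∃ l, Converges F u l := ⟨l, h⟩
  rw [BCHRec.limit, dif_pos h']
  exact h'.choose_spec

theorem Converges.mem {u : ℕ → M} {l : M} {n : ℕ} (h : Converges F u l) (hu : ∀ k, u k ∈ F n) :
    l ∈ F n := by
  obtain ⟨N, hN⟩ := h n
  have h1 := (F n).sub_mem (hu N) (hN N le_rfl)
  rwa [sub_sub_cancel] at h1

/-- Level `0` is left out so that this also serves filtrations about whose zeroth term nothing is
known. -/
theorem converges_of_sub_mem (hF : Antitone F) {u : ℕ → M} {l : M}
    (h : ∀ n, 1 ≤ n → u n - l ∈ F n) : Converges F u l := fun n =>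
  ⟨n + 1, fun k hk => hF (by omega) (h k (by omega))⟩

end Limits

/-! ### The recursion -/

section Recursion

variable {K M : Type*} [Field K] [AddCommGroup M] [Module K M] {F : ℕ → Submodule K M}
  {op : M → M → M}

/-- The properties of the components of the series `C` from which the recursion is studied. -/
structure IsComponents (F : ℕ → Submodule K M) (c : ℕ → M → M → M) : Prop where
  zero : ∀ u v, c 0 u v = 0
  one : ∀ u v, c 1 u v = u + v
  mem : ∀ n, 1 ≤ n → ∀ u ∈ F 1, ∀ v ∈ F 1, c n u v ∈ F n
  sub_mem : ∀ n, 2 ≤ n → ∀ k, 1 ≤ k → ∀ u ∈ F 1, ∀ v ∈ F 1, ∀ u' ∈ F 1, ∀ v' ∈ F 1,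
    u - u' ∈ F k → v - v' ∈ F k → c n u v - c n u' v' ∈ F (k + 1)

/-- The sum of the components. -/
def seriesC (F : ℕ → Submodule K M) (c : ℕ → M → M → M) (u v : M) : M :=
  limit F fun N => ∑ n ∈ Finset.range N, c n u v

theorem IsComponents.partial_mem (hF : Antitone F) {c : ℕ → M → M → M} (hc : IsComponents F c)
    {u v : M} (hu : u ∈ F 1) (hv : v ∈ F 1) (N : ℕ) : ∑ n ∈ Finset.range N, c n u v ∈ F 1 := by
  refine Submodule.sum_mem _ fun n _ => ?_
  rcases Nat.eq_zero_or_pos n with rfl | hn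
  · rw [hc.zero]; exact Submodule.zero_mem _
  · exact hF hn (hc.mem n hn u hu v hv)

theorem IsComponents.converges (hF : IsCompleteFiltration op F) {c : ℕ → M → M → M}
    (hc : IsComponents F c) {u v : M} (hu : u ∈ F 1) (hv : v ∈ F 1) :
    Converges F (fun N => ∑ n ∈ Finset.range N, c n u v) (seriesC F c u v) := by
  obtain ⟨l, hl⟩ := hF.complete (fun N => ∑ n ∈ Finset.range N, c n u v) fun m n hmn => by
    rw [← neg_sub, ← Finset.sum_Ico_eq_sub _ hmn]
    refine Submodule.neg_mem _ (Submodule.sum_mem _ fun k hk => ?_)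
    rw [Finset.mem_Ico] at hk
    rcases Nat.eq_zero_or_pos k with rfl | hk0
    · rw [hc.zero]; exact Submodule.zero_mem _
    · exact hF.antitone hk.1 (hc.mem k hk0 u hu v hv)
  exact (converges_of_sub_mem hF.antitone fun n _ => hl n).limit

theorem IsComponents.seriesC_mem (hF : IsCompleteFiltration op F) {c : ℕ → M → M → M}
    (hc : IsComponents F c) {u v : M} (hu : u ∈ F 1) (hv : v ∈ F 1) : seriesC F c u v ∈ F 1 :=
  (hc.converges hF hu hv).mem (hc.partial_mem hF.antitone hu hv)

theorem IsComponents.bch_sub_bch_mem (hF : IsCompleteFiltration op F) {c : ℕ → M → M → M}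
    (hc : IsComponents F c) {k : ℕ} (hk : 1 ≤ k) {u v u' v' : M} (hu : u ∈ F 1) (hv : v ∈ F 1)
    (hu' : u' ∈ F 1) (hv' : v' ∈ F 1) (huu : u - u' ∈ F k) (hvv : v - v' ∈ F k) :
    bch (seriesC F c) u v - bch (seriesC F c) u' v' ∈ F (k + 1) := by
  obtain ⟨N, hN⟩ := hc.converges hF hu hv (k + 1)
  obtain ⟨N', hN'⟩ := hc.converges hF hu' hv' (k + 1)
  -- This index passes both thresholds and leaves room to split off the components of degrees `0`
  -- and `1`, which `bch` cancels.
  have h1 := hN (N + N' + 2) (by omega)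
  have h2 := hN' (N + N' + 2) (by omega)
  have h3 : ∑ n ∈ Finset.range (N + N'), (c (n + 1 + 1) u v - c (n + 1 + 1) u' v') ∈ F (k + 1) :=
    Submodule.sum_mem _ fun n _ =>
      hc.sub_mem _ (by omega) k hk u hu v hv u' hu' v' hv' huu hvv
  have e : bch (seriesC F c) u v - bch (seriesC F c) u' v' =
      ∑ n ∈ Finset.range (N + N'), (c (n + 1 + 1) u v - c (n + 1 + 1) u' v') -
        (∑ n ∈ Finset.range (N + N' + 2), c n u v - seriesC F c u v) +
        (∑ n ∈ Finset.range (N + N' + 2), c n u' v' - seriesC F c u' v') := by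
    rw [Finset.sum_range_succ', Finset.sum_range_succ', Finset.sum_range_succ' (fun n => c n u' v'),
      Finset.sum_range_succ' (fun n => c (n + 1) u' v'), Finset.sum_sub_distrib]
    simp only [zero_add, hc.zero, hc.one, bch]
    abel
  rw [e]
  exact Submodule.add_mem _ (Submodule.sub_mem _ h3 h1) h2

variable {P : M →ₗ[K] M}

theorem tilde_apply (P : M →ₗ[K] M) (x : M) : tilde P x = x - P x := rfl

theorem tilde_mem (hP : ∀ n, ∀ x ∈ F n, P x ∈ F n) {n : ℕ} {x : M} (hx : x ∈ F n) :
    tilde P x ∈ F n :=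
  (F n).sub_mem hx (hP n x hx)

theorem IsComponents.bch_mem (hF : IsCompleteFiltration op F) {c : ℕ → M → M → M}
    (hc : IsComponents F c) {u v : M} (hu : u ∈ F 1) (hv : v ∈ F 1) :
    bch (seriesC F c) u v ∈ F 1 :=
  (F 1).sub_mem ((F 1).sub_mem (hc.seriesC_mem hF hu hv) hu) hv

theorem IsComponents.chiSeq_mem (hF : IsCompleteFiltration op F) {c : ℕ → M → M → M}
    (hc : IsComponents F c) (hP : ∀ n, ∀ x ∈ F n, P x ∈ F n) {a : M} (ha : a ∈ F 1) (n : ℕ) :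
    chiSeq (seriesC F c) P a n ∈ F 1 := by
  induction n with
  | zero => exact ha
  | succ n ih => exact (F 1).sub_mem ha (hc.bch_mem hF (hP 1 _ ih) (tilde_mem hP ih))

/-- This is the contraction estimate behind the recursion: `P` and `P̃` both preserve closeness, and
`bch` improves it by one level. -/
theorem IsComponents.bch_split_sub_mem (hF : IsCompleteFiltration op F) {c : ℕ → M → M → M}
    (hc : IsComponents F c) (hP : ∀ n, ∀ x ∈ F n, P x ∈ F n) {k : ℕ} (hk : 1 ≤ k) {x y : M}
    (hx : x ∈ F 1) (hy : y ∈ F 1) (hxy : x - y ∈ F k) :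
    bch (seriesC F c) (P x) (tilde P x) - bch (seriesC F c) (P y) (tilde P y) ∈ F (k + 1) := by
  refine hc.bch_sub_bch_mem hF hk (hP 1 _ hx) (tilde_mem hP hx) (hP 1 _ hy) (tilde_mem hP hy) ?_ ?_
  · rw [← map_sub]; exact hP k _ hxy
  · rw [← map_sub]; exact tilde_mem hP hxy

theorem IsComponents.chiSeq_sub_succ_mem (hF : IsCompleteFiltration op F) {c : ℕ → M → M → M}
    (hc : IsComponents F c) (hP : ∀ n, ∀ x ∈ F n, P x ∈ F n) {a : M} (ha : a ∈ F 1) (n : ℕ) :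
    chiSeq (seriesC F c) P a n - chiSeq (seriesC F c) P a (n + 1) ∈ F (n + 1) := by
  induction n with
  | zero => exact (F 1).sub_mem (hc.chiSeq_mem hF hP ha 0) (hc.chiSeq_mem hF hP ha 1)
  | succ n ih =>
    have h := hc.bch_split_sub_mem hF hP (Nat.le_add_left 1 n) (hc.chiSeq_mem hF hP ha n)
      (hc.chiSeq_mem hF hP ha (n + 1)) ih
    rw [← neg_mem_iff] at h
    simpa [chiSeq] using h

theorem IsComponents.chi_converges (hF : IsCompleteFiltration op F) {c : ℕ → M → M → M}
    (hc : IsComponents F c) (hP : ∀ n, ∀ x ∈ F n, P x ∈ F n) {a : M} (ha : a ∈ F 1) :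
    Converges F (chiSeq (seriesC F c) P a) (chi F (seriesC F c) P a) := by
  obtain ⟨l, hl⟩ := hF.complete (chiSeq (seriesC F c) P a) fun m n hmn => by
    induction n, hmn using Nat.le_induction with
    | base => simp
    | succ n hmn ih =>
      rw [← sub_add_sub_cancel _ (chiSeq (seriesC F c) P a n)]
      exact Submodule.add_mem _ ih
        (hF.antitone (by omega) (hc.chiSeq_sub_succ_mem hF hP ha n))
  exact (converges_of_sub_mem hF.antitone fun n _ => hl n).limit

theorem IsComponents.chi_mem (hF : IsCompleteFiltration op F) {c : ℕ → M → M → M}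
    (hc : IsComponents F c) (hP : ∀ n, ∀ x ∈ F n, P x ∈ F n) {a : M} (ha : a ∈ F 1) :
    chi F (seriesC F c) P a ∈ F 1 :=
  (hc.chi_converges hF hP ha).mem (hc.chiSeq_mem hF hP ha)

/-- The fixed point equation `χ(a) = a - BCH(P(χ(a)), P̃(χ(a)))`, written in terms of `C`. -/
theorem IsComponents.seriesC_chi (hF : IsCompleteFiltration op F) {c : ℕ → M → M → M}
    (hc : IsComponents F c) (hP : ∀ n, ∀ x ∈ F n, P x ∈ F n) {a : M} (ha : a ∈ F 1) :
    seriesC F c (P (chi F (seriesC F c) P a)) (tilde P (chi F (seriesC F c) P a)) = a := by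
  set x := chi F (seriesC F c) P a with hx
  have hx1 : x ∈ F 1 := hc.chi_mem hF hP ha
  rw [← sub_eq_zero]
  refine hF.separated _ fun n => ?_
  obtain ⟨N, hN⟩ := hc.chi_converges hF hP ha (n + 1)
  have h1 := hN N le_rfl
  have h2 := hN (N + 1) (by omega)
  rw [← hx] at h1 h2
  have h3 := hc.bch_split_sub_mem hF hP (Nat.le_add_left 1 n) (hc.chiSeq_mem hF hP ha N) hx1 h1
  -- As `P x + tilde P x = x`, the left side is `BCH(x) + x - a`, where `BCH(z)` stands for `BCH(P
  -- z, P̃ z)`. The recursion replaces `a` by `χ₍N+1₎ + BCH(χ₍N₎)`, leaving two small differences.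
  have e : seriesC F c (P x) (tilde P x) - a =
      -((bch (seriesC F c) (P (chiSeq (seriesC F c) P a N))
        (tilde P (chiSeq (seriesC F c) P a N)) - bch (seriesC F c) (P x) (tilde P x)) +
        (chiSeq (seriesC F c) P a (N + 1) - x)) := by
    have e1 : seriesC F c (P x) (tilde P x) = bch (seriesC F c) (P x) (tilde P x) + x := by
      rw [bch, tilde_apply]; abel
    rw [e1, chiSeq]
    abel
  rw [e]
  exact Submodule.neg_mem _
    (Submodule.add_mem _ (hF.antitone (by omega) h3) (hF.antitone (by omega) h2))

/-- Everything follows from `C ∘ D_P = id` on `F 1`: a map with a right inverse is injective on the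
image of that inverse, and `exp_eq` is `he` applied to `D_P a`. -/
theorem IsComponents.factorization (hF : IsCompleteFiltration op F) {c : ℕ → M → M → M}
    (hc : IsComponents F c) (hP : ∀ n, ∀ x ∈ F n, P x ∈ F n) {E : Type*} [Ring E] {e : M → E}
    (he : ∀ u ∈ F 1, ∀ v ∈ F 1, e u * e v = e (seriesC F c u v)) :
    Factorization F (seriesC F c) P e := by
  have hbij : ∀ B : Set M, B ⊆ (F 1 : Set M) →
      Set.BijOn (fun p : M × M => seriesC F c p.1 p.2) (DP F (seriesC F c) P '' B) B := by
    intro B hB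
    refine ⟨?_, ?_, ?_⟩
    · rintro _ ⟨a, ha, rfl⟩
      have := hc.seriesC_chi hF hP (hB ha)
      simpa only [DP, this] using ha
    · rintro _ ⟨a, ha, rfl⟩ _ ⟨b, hb, rfl⟩ hab
      simp only [DP, hc.seriesC_chi hF hP (hB ha), hc.seriesC_chi hF hP (hB hb)] at hab
      rw [hab]
    · intro a ha
      exact ⟨_, ⟨a, ha, rfl⟩, hc.seriesC_chi hF hP (hB ha)⟩
  have hchi : ∀ a ∈ F 1, chi F (seriesC F c) P a ∈ F 1 := fun a ha => hc.chi_mem hF hP ha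
  exact
    { C_mem := fun u hu v hv => hc.seriesC_mem hF hu hv
      exp_mul_exp := he
      chi_converges := fun a ha => hc.chi_converges hF hP ha
      chi_mem := hchi
      exp_eq := fun a ha => by
        rw [he _ (hP 1 _ (hchi a ha)) _ (tilde_mem hP (hchi a ha)), hc.seriesC_chi hF hP ha]
      DP_mapsTo := fun a ha => ⟨hP 1 _ (hchi a ha), tilde_mem hP (hchi a ha)⟩
      rightInv := fun a ha => hc.seriesC_chi hF hP ha
      bijOn := hbij _ subset_rfl
      bijOn_subset := hbij }

end Recursion

/-! ### Components given by words -/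

section WordComponents

variable {K M : Type*} [Field K] [AddCommGroup M] [Module K M] {F : ℕ → Submodule K M}
  {op : M → M → M}

theorem wordEval_cons (op : M → M → M) (f : Fin 2 → M) (i : Fin 2) {w : List (Fin 2)}
    (hw : w ≠ []) : wordEval op f (i :: w) = op (f i) (wordEval op f w) := by
  obtain ⟨j, w, rfl⟩ := List.exists_cons_of_ne_nil hw
  rfl

theorem wordEval_mem (hF : IsCompleteFiltration op F) {f : Fin 2 → M} (hf : ∀ i, f i ∈ F 1)
    {w : List (Fin 2)} (hw : w ≠ []) : wordEval op f w ∈ F w.length := by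
  induction w with
  | nil => exact absurd rfl hw
  | cons i w ih =>
    rcases eq_or_ne w [] with rfl | hw'
    · exact hf i
    · rw [wordEval_cons op f i hw', List.length_cons, add_comm]
      exact hF.op_mem _ _ _ (hf i) _ (ih hw')

theorem op_sub_op_mem (hF : IsCompleteFiltration op F)
    (hl : ∀ x y z, op (x - y) z = op x z - op y z) (hr : ∀ x y z, op x (y - z) = op x y - op x z)
    {k : ℕ} {x x' y y' : M} (hx : x ∈ F 1) (hy' : y' ∈ F 1) (hxx : x - x' ∈ F k)
    (hyy : y - y' ∈ F k) : op x y - op x' y' ∈ F (k + 1) := by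
  have e : op x y - op x' y' = op x (y - y') + op (x - x') y' := by
    rw [hl, hr]; abel
  rw [e]
  refine Submodule.add_mem _ ?_ (hF.op_mem _ _ _ hxx _ hy')
  rw [add_comm]
  exact hF.op_mem _ _ _ hx _ hyy

/-- In `x y - x' y' = x (y - y') + (x - x') y'` the unchanged factor lies in `F 1` and gains one
level. The weaker bound is carried along because the tail of a word may be a single letter, for
which there is no gain. -/
theorem wordEval_sub_mem (hF : IsCompleteFiltration op F)
    (hl : ∀ x y z, op (x - y) z = op x z - op y z) (hr : ∀ x y z, op x (y - z) = op x y - op x z)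
    {f g : Fin 2 → M} (hf : ∀ i, f i ∈ F 1) (hg : ∀ i, g i ∈ F 1) {k : ℕ}
    (h : ∀ i, f i - g i ∈ F k) (w : List (Fin 2)) :
    wordEval op f w - wordEval op g w ∈ F k ∧
      (2 ≤ w.length → wordEval op f w - wordEval op g w ∈ F (k + 1)) := by
  induction w with
  | nil => simp [wordEval]
  | cons i w ih =>
    rcases eq_or_ne w [] with rfl | hw
    · exact ⟨h i, by simp⟩
    · have hw1 : 1 ≤ w.length := List.length_pos_iff.2 hw
      have key : wordEval op f (i :: w) - wordEval op g (i :: w) ∈ F (k + 1) := by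
        rw [wordEval_cons op f i hw, wordEval_cons op g i hw]
        exact op_sub_op_mem hF hl hr (hf i) (hF.antitone hw1 (wordEval_mem hF hg hw)) (h i) ih.1
      exact ⟨hF.antitone (Nat.le_succ k) key, fun _ => key⟩

/-- The component of degree `n` of a series with coefficients `a`. -/
def wordComponent (op : M → M → M) (a : List (Fin 2) → K) (n : ℕ) (u v : M) : M :=
  ∑ w : Fin n → Fin 2, a (List.ofFn w) • wordEval op ![u, v] (List.ofFn w)

/-- Of the coefficients only the normalisation on letters matters, so associative products and Lie
brackets are treated alike. -/
theorem isComponents_wordComponent (hF : IsCompleteFiltration op F)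
    (hl : ∀ x y z, op (x - y) z = op x z - op y z) (hr : ∀ x y z, op x (y - z) = op x y - op x z)
    {a : List (Fin 2) → K} (ha : ∀ i, a [i] = 1) : IsComponents F (wordComponent op a) where
  zero u v := by simp [wordComponent, wordEval]
  one u v := by
    rw [wordComponent, ← (Equiv.funUnique (Fin 1) (Fin 2)).symm.sum_comp]
    simp [wordEval, ha]
  mem n hn u hu v hv := by
    refine Submodule.sum_mem _ fun w _ => Submodule.smul_mem _ _ ?_
    have h := wordEval_mem (f := ![u, v]) hF (by simp [Fin.forall_fin_two, hu, hv])
      (w := List.ofFn w) (by rw [← List.length_pos_iff, List.length_ofFn]; exact hn)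
    simpa using h
  sub_mem n hn k _ u hu v hv u' hu' v' hv' huu hvv := by
    rw [wordComponent, wordComponent, ← Finset.sum_sub_distrib]
    refine Submodule.sum_mem _ fun w _ => ?_
    rw [← smul_sub]
    refine Submodule.smul_mem _ _ ((wordEval_sub_mem hF hl hr ?_ ?_ ?_ _).2 (by simpa using hn)) <;>
      simp [Fin.forall_fin_two, *]

end WordComponents

/-! ### Exponentials of filtered spaces mapped into algebras -/

section ExpSetting

open Finset

variable {K M E : Type*} [Field K] [AddCommGroup M] [Module K M] [Ring E] [Algebra K E]

/-- A map `e` from `M`, filtered by `F`, to an algebra `E`, filtered by `G`, such that elements of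
`e (F 1)` have exponentials. Nothing is asked of `G 0`. -/
structure IsExpSetting (F : ℕ → Submodule K M) (G : ℕ → Submodule K E) (e : M → E) : Prop where
  antitone : Antitone G
  mul_left_mem : ∀ n, 1 ≤ n → ∀ x ∈ G n, ∀ y, y * x ∈ G n
  mul_right_mem : ∀ n, 1 ≤ n → ∀ x ∈ G n, ∀ y, x * y ∈ G n
  map_sub_mem : ∀ n, 1 ≤ n → ∀ a b, a - b ∈ F n → e a - e b ∈ G n
  prod_mem : ∀ l : List M, l ≠ [] → (∀ a ∈ l, a ∈ F 1) → (l.map e).prod ∈ G l.length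
  separated : ∀ x, (∀ n, 1 ≤ n → x ∈ G n) → x = 0
  complete : ∀ f : ℕ → E, (∀ m n, 1 ≤ m → m ≤ n → f m - f n ∈ G m) →
    ∃ l, ∀ n, 1 ≤ n → f n - l ∈ G n

variable {F : ℕ → Submodule K M} {G : ℕ → Submodule K E} {e : M → E}

theorem IsExpSetting.pow_mem (h : IsExpSetting F G e) {a : M} (ha : a ∈ F 1) {k : ℕ} (hk : 1 ≤ k) :
    e a ^ k ∈ G k := by
  have := h.prod_mem (List.replicate k a) (by simp; omega)
    fun b hb => (List.eq_of_mem_replicate hb) ▸ ha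
  simpa using this

theorem IsExpSetting.expPartial_converges (h : IsExpSetting F G e) {a : M} (ha : a ∈ F 1) :
    Converges G (expPartial K (e a)) (filExp G (e a)) := by
  obtain ⟨l, hl⟩ := h.complete (expPartial K (e a)) fun m n hm hmn => by
    rw [expPartial, expPartial, ← neg_sub, ← sum_Ico_eq_sub _ hmn]
    refine Submodule.neg_mem _ (Submodule.sum_mem _ fun k hk => Submodule.smul_mem _ _ ?_)
    rw [mem_Ico] at hk
    exact h.antitone hk.1 (h.pow_mem ha (hm.trans hk.1))
  exact (converges_of_sub_mem h.antitone hl).limit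

theorem IsExpSetting.pow_sub_pow_mem (h : IsExpSetting F G e) {n : ℕ} (hn : 1 ≤ n) {x y : E}
    (hxy : x - y ∈ G n) (k : ℕ) : x ^ k - y ^ k ∈ G n := by
  induction k with
  | zero => simp
  | succ k ih =>
    have e : x ^ (k + 1) - y ^ (k + 1) = x ^ k * (x - y) + (x ^ k - y ^ k) * y := by
      noncomm_ring
    rw [e]
    exact Submodule.add_mem _ (h.mul_left_mem n hn _ hxy _) (h.mul_right_mem n hn _ ih _)

theorem IsExpSetting.expPartial_sub_mem (h : IsExpSetting F G e) {n : ℕ} (hn : 1 ≤ n) {x y : E}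
    (hxy : x - y ∈ G n) (N : ℕ) : expPartial K x N - expPartial K y N ∈ G n := by
  rw [expPartial, expPartial, ← sum_sub_distrib]
  refine Submodule.sum_mem _ fun k _ => ?_
  rw [← smul_sub]
  exact Submodule.smul_mem _ _ (h.pow_sub_pow_mem hn hxy k)

/-- `exp u * exp v = exp (C(u, v))` when `e` maps the partial sums of `C(u, v)` to the values of
the components of `log (exp x * exp y)`. -/
theorem IsExpSetting.filExp_mul_filExp [CharZero K] (h : IsExpSetting F G e) {u v w : M}
    {s : ℕ → M} (hu : u ∈ F 1) (hv : v ∈ F 1) (hw : w ∈ F 1) (hs : Converges F s w)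
    (hes : ∀ N, e (s N) =
      ncEval K ![e u, e v] (∑ n ∈ range N, PowerSeries.coeff n bchSeries)) :
    filExp G (e u) * filExp G (e v) = filExp G (e w) := by
  rw [← sub_eq_zero]
  refine h.separated _ fun n hn => ?_
  obtain ⟨Nu, hNu⟩ := h.expPartial_converges hu n
  obtain ⟨Nv, hNv⟩ := h.expPartial_converges hv n
  obtain ⟨Nw, hNw⟩ := h.expPartial_converges hw n
  obtain ⟨Ns, hNs⟩ := hs n
  -- Past all four thresholds every limit may be replaced by its partial sum modulo `G n`; `N ≥ n`
  -- also places the truncation error of the formal identity in `G n`.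
  set N := n + Nu + Nv + Nw + Ns with hN
  have h1 := hNu N (by omega)
  have h2 := hNv N (by omega)
  have h3 := hNw N (by omega)
  have h4 := h.expPartial_sub_mem hn (h.map_sub_mem n hn _ _ (hNs N (by omega))) N
  have h5 : expPartial K (e u) N * expPartial K (e v) N - expPartial K (e (s N)) N ∈ G n := by
    rw [hes]
    refine expPartial_mul_expPartial_sub_mem (f := ![e u, e v]) fun l hl => ?_
    have hl' : l.map ![e u, e v] = (l.map ![u, v]).map e := by
      rw [List.map_map]
      refine List.map_congr_left fun i _ => ?_
      fin_cases i <;> rfl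
    rw [hl']
    refine h.antitone (show n ≤ (l.map ![u, v]).length by rw [List.length_map]; omega)
      (h.prod_mem _ ?_ ?_)
    · rw [← List.length_pos_iff, List.length_map]; omega
    · intro a ha
      obtain ⟨i, _, rfl⟩ := List.mem_map.1 ha
      fin_cases i <;> assumption
  have e1 : filExp G (e u) * filExp G (e v) - filExp G (e w) =
      -((expPartial K (e u) N - filExp G (e u)) * filExp G (e v)) -
        expPartial K (e u) N * (expPartial K (e v) N - filExp G (e v)) +
        (expPartial K (e u) N * expPartial K (e v) N - expPartial K (e (s N)) N) +
        (expPartial K (e (s N)) N - expPartial K (e w) N) +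
        (expPartial K (e w) N - filExp G (e w)) := by
    noncomm_ring
  rw [e1]
  exact Submodule.add_mem _ (Submodule.add_mem _ (Submodule.add_mem _ (Submodule.sub_mem _
    (Submodule.neg_mem _ (h.mul_right_mem n hn _ h1 _)) (h.mul_left_mem n hn _ h2 _)) h5) h4) h3

/-- The factorization theorem for a filtered space with components `c` of `C` that are the images
of the components of `log (exp x * exp y)`. -/
theorem IsExpSetting.main [CharZero K] {op : M → M → M} {P : M →ₗ[K] M}
    (hF : IsCompleteFiltration op F) (hP : ∀ n, ∀ x ∈ F n, P x ∈ F n) {c : ℕ → M → M → M}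
    (hc : IsComponents F c) (h : IsExpSetting F G e)
    (hec : ∀ u v N, e (∑ n ∈ range N, c n u v) =
      ncEval K ![e u, e v] (∑ n ∈ range N, PowerSeries.coeff n bchSeries)) :
    (∀ u ∈ F 1, ∀ v ∈ F 1,
        Converges F (fun N => ∑ n ∈ range N, c n u v) (seriesC F c u v)) ∧
      (∀ a ∈ F 1, Converges G (expPartial K (e a)) (filExp G (e a))) ∧
      Factorization F (seriesC F c) P (fun a => filExp G (e a)) :=
  ⟨fun _ hu _ hv => hc.converges hF hu hv, fun _ ha => h.expPartial_converges ha,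
    hc.factorization hF hP fun u hu v hv =>
      h.filExp_mul_filExp hu hv (hc.seriesC_mem hF hu hv) (hc.converges hF hu hv) (hec u v)⟩

end ExpSetting

/-! ### Associative algebras -/

section Assoc

open Finset

variable {K A E : Type*} [Field K] [NonUnitalRing A] [Module K A] [Ring E] [Algebra K E]

theorem comp_vec_two {M N : Type*} (e : M → N) (u v : M) : e ∘ ![u, v] = ![e u, e v] := by
  ext i
  fin_cases i <;> rfl

theorem map_wordEval_mul (e : A →ₗ[K] E) (he : ∀ x y, e (x * y) = e x * e y) (f : Fin 2 → A)
    {w : List (Fin 2)} (hw : w ≠ []) :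
    e (wordEval (fun a b => a * b) f w) = (w.map (e ∘ f)).prod := by
  induction w with
  | nil => exact absurd rfl hw
  | cons i w ih =>
    rcases eq_or_ne w [] with rfl | hw'
    · simp [wordEval]
    · rw [wordEval_cons _ f i hw', he, ih hw', List.map_cons, List.prod_cons]; rfl

theorem coeff_zero_bchSeries : PowerSeries.coeff 0 bchSeries = 0 := by
  rw [PowerSeries.coeff_zero_eq_constantCoeff_apply, constantCoeff_bchSeries]

theorem map_assocComponent [CharZero K] (e : A →ₗ[K] E) (he : ∀ x y, e (x * y) = e x * e y) (u v : A)
    (n : ℕ) : e (assocComponent K n u v) =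
      ncEval K ![e u, e v] (PowerSeries.coeff n bchSeries) := by
  -- Degree `0` is separate: `wordEval` sends the empty word to `0`, whereas `ncEval` sends it to
  -- `1`. Both components vanish there.
  rcases Nat.eq_zero_or_pos n with rfl | hn
  · rw [coeff_zero_bchSeries, map_zero]
    simp [assocComponent, wordEval]
  rw [coeff_bchSeries, assocComponent, map_sum, map_sum]
  refine sum_congr rfl fun w _ => ?_
  have hw : List.ofFn w ≠ [] := by rw [← List.length_pos_iff, List.length_ofFn]; exact hn
  rw [map_smul, ncEval_smul, ncEval_word, map_wordEval_mul e he _ hw, comp_vec_two]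

theorem map_assocCPartial [CharZero K] (e : A →ₗ[K] E) (he : ∀ x y, e (x * y) = e x * e y) (u v : A)
    (N : ℕ) : e (∑ n ∈ range N, assocComponent K n u v) =
      ncEval K ![e u, e v] (∑ n ∈ range N, PowerSeries.coeff n bchSeries) := by
  rw [map_sum, map_sum]
  exact sum_congr rfl fun n _ => map_assocComponent e he u v n

theorem isComponents_assocComponent {F : ℕ → Submodule K A}
    (hF : IsCompleteFiltration (fun a b => a * b) F) : IsComponents F (assocComponent K) :=
  isComponents_wordComponent (a := fun w => (bchCoeff w : K)) hF sub_mul mul_sub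
    fun i => by simp [bchCoeff_singleton]

/-- The exponential of a unital algebra with values in itself. -/
theorem isExpSetting_id {F : ℕ → Submodule K E}
    (hF : IsCompleteFiltration (fun a b => a * b) F) : IsExpSetting F F (fun a => a) where
  antitone := hF.antitone
  mul_left_mem n _ x hx y := by
    simpa using hF.op_mem 0 n y (by rw [hF.zero_eq_top]; trivial) x hx
  mul_right_mem n _ x hx y := by
    simpa using hF.op_mem n 0 x hx y (by rw [hF.zero_eq_top]; trivial)
  map_sub_mem n _ a b h := h
  prod_mem l hl h := by
    rw [List.map_id']
    clear hl
    induction l with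
    | nil => simp [hF.zero_eq_top]
    | cons a l ih =>
      rw [List.prod_cons, List.length_cons, add_comm]
      exact hF.op_mem _ _ _ (h a (by simp)) _ (ih fun b hb => h b (by simp [hb]))
  separated x hx := hF.separated x fun n => hF.antitone (Nat.le_succ n) (hx (n + 1) (by omega))
  complete f hf := by
    obtain ⟨l, hl⟩ := hF.complete (fun n => f (n + 1)) fun m n hmn =>
      hF.antitone (Nat.le_succ m) (hf (m + 1) (n + 1) (by omega) (by omega))
    refine ⟨l, fun n hn => ?_⟩
    rw [← sub_add_sub_cancel _ (f (n + 1))]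
    exact Submodule.add_mem _ (hf n (n + 1) hn (by omega)) (hl n)

variable [IsScalarTower K A A] [SMulCommClass K A A]

/-- The exponential of an algebra with values in the algebra obtained by adjoining a unit. -/
theorem isExpSetting_unitization {F : ℕ → Submodule K A}
    (hF : IsCompleteFiltration (fun a b => a * b) F) :
    IsExpSetting F (unitizationFil F) (fun a => (a : Unitization K A)) where
  antitone m n hmn := Submodule.map_mono (hF.antitone hmn)
  mul_left_mem n _ x hx y := by
    obtain ⟨a, ha, rfl⟩ := hx
    refine ⟨y.fst • a + y.snd * a, Submodule.add_mem _ (Submodule.smul_mem _ _ ha) ?_, ?_⟩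
    · simpa using hF.op_mem 0 n y.snd (by rw [hF.zero_eq_top]; trivial) a ha
    · ext <;> simp
  mul_right_mem n _ x hx y := by
    obtain ⟨a, ha, rfl⟩ := hx
    refine ⟨y.fst • a + a * y.snd, Submodule.add_mem _ (Submodule.smul_mem _ _ ha) ?_, ?_⟩
    · simpa using hF.op_mem n 0 a ha y.snd (by rw [hF.zero_eq_top]; trivial)
    · ext <;> simp
  map_sub_mem n _ a b h := ⟨a - b, h, by simp⟩
  prod_mem l hl h := by
    induction l with
    | nil => exact absurd rfl hl
    | cons a l ih =>
      rcases eq_or_ne l [] with rfl | hl'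
      · exact ⟨a, h a (by simp), by simp⟩
      · obtain ⟨b, hb, hbl⟩ := ih hl' fun b hb => h b (by simp [hb])
        rw [List.map_cons, List.prod_cons, List.length_cons, add_comm, ← hbl]
        exact ⟨a * b, hF.op_mem _ _ _ (h a (by simp)) _ hb, by simp⟩
  separated x hx := by
    obtain ⟨a, _, rfl⟩ := hx 1 le_rfl
    rw [hF.separated a, map_zero]
    intro n
    obtain ⟨b, hb, hba⟩ := hx (n + 1) (by omega)
    rw [Unitization.inr_injective hba] at hb
    exact hF.antitone (Nat.le_succ n) hb
  complete f hf := by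
    -- The sequence need not lie in `A`, but from index `1` on its differences from `f 1` do, so
    -- completeness of `A` applies to them.
    have hg : ∀ n, ∃ a : A, f (n + 1) - f 1 = (a : Unitization K A) := by
      intro n
      obtain ⟨a, _, ha⟩ := hf 1 (n + 1) le_rfl (by omega)
      refine ⟨-a, ?_⟩
      rw [← neg_sub, ← ha]
      simp
    choose g hg using hg
    have hgm : ∀ m n, f (m + 1) - f (n + 1) = ((g m - g n : A) : Unitization K A) := by
      intro m n
      rw [Unitization.inr_sub, ← hg, ← hg]; abel
    obtain ⟨l, hl⟩ := hF.complete g fun m n hmn => by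
      obtain ⟨a, ha, hae⟩ := hf (m + 1) (n + 1) (by omega) (by omega)
      rw [hgm] at hae
      rw [← Unitization.inr_injective hae]
      exact hF.antitone (Nat.le_succ m) ha
    refine ⟨f 1 + (l : Unitization K A), fun n hn => ?_⟩
    rw [← sub_add_sub_cancel _ (f (n + 1))]
    refine Submodule.add_mem _ (hf n (n + 1) hn (by omega)) ⟨g n - l, hl n, ?_⟩
    rw [Unitization.inrHom_apply, Unitization.inr_sub, ← hg]
    abel

end Assoc

/-! ### Lie algebras -/

section Lie

open Finset

variable {K L E : Type*} [Field K] [LieRing L] [LieAlgebra K L] [Ring E] [Algebra K E]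

/-- `dynkin (word w)` is the same nested commutator formed in the free algebra, and `e` turns
brackets into commutators. -/
theorem map_wordEval_lie [CharZero K] (e : L →ₗ[K] E)
    (he : ∀ x y, e ⁅x, y⁆ = e x * e y - e y * e x) (f : Fin 2 → L) (w : List (Fin 2)) :
    e (wordEval (fun a b => ⁅a, b⁆) f w) = ncEval K (e ∘ f) (dynkin (word w)) := by
  rw [dynkin, wordLift_word]
  induction w with
  | nil => simp [wordEval]
  | cons i w ih =>
    have hi : e (f i) = ncEval K (e ∘ f) (letter i) := by simp [ncEval_word]
    rcases eq_or_ne w [] with rfl | hw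
    · exact hi
    · rw [wordEval_cons _ f i hw, wordEval_cons _ letter i hw, he, ih, Ring.lie_def, map_sub,
        map_mul, map_mul, hi]

/-- Up to the factor `1 / n`, the bracket expression maps to the value of Dynkin's operator on the
component, hence to `n` times the component; characteristic zero allows the division. Injectivity of
`e` plays no role. -/
theorem map_lieComponent [CharZero K] (e : L →ₗ[K] E)
    (he : ∀ x y, e ⁅x, y⁆ = e x * e y - e y * e x) (u v : L) (n : ℕ) :
    e (lieComponent K n u v) = ncEval K ![e u, e v] (PowerSeries.coeff n bchSeries) := by
  rcases Nat.eq_zero_or_pos n with rfl | hn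
  · rw [coeff_zero_bchSeries, map_zero]
    simp [lieComponent]
  have h := dynkin_coeff_bchSeries n
  rw [coeff_bchSeries, map_sum, ← coeff_bchSeries] at h
  have h' := congrArg (ncEval K ![e u, e v]) h
  rw [ncEval_smul, Rat.cast_natCast, map_sum] at h'
  rw [lieComponent, map_smul, map_sum, inv_smul_eq_iff₀ (by exact_mod_cast hn.ne'), ← h']
  refine sum_congr rfl fun w _ => ?_
  rw [map_smul, map_smul, ncEval_smul, map_wordEval_lie e he, comp_vec_two]

theorem map_lieCPartial [CharZero K] (e : L →ₗ[K] E)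
    (he : ∀ x y, e ⁅x, y⁆ = e x * e y - e y * e x) (u v : L) (N : ℕ) :
    e (∑ n ∈ range N, lieComponent K n u v) =
      ncEval K ![e u, e v] (∑ n ∈ range N, PowerSeries.coeff n bchSeries) := by
  rw [map_sum, map_sum]
  exact sum_congr rfl fun n _ => map_lieComponent e he u v n

theorem lieComponent_eq_wordComponent : (lieComponent K : ℕ → L → L → L) =
    wordComponent (fun a b => ⁅a, b⁆) fun w => (w.length : K)⁻¹ * (bchCoeff w : K) := by
  ext n u v
  rw [lieComponent, wordComponent, smul_sum]
  refine sum_congr rfl fun w _ => ?_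
  rw [smul_smul, List.length_ofFn]

theorem isComponents_lieComponent {F : ℕ → Submodule K L}
    (hF : IsCompleteFiltration (fun a b => ⁅a, b⁆) F) : IsComponents F (lieComponent K) := by
  rw [lieComponent_eq_wordComponent]
  exact isComponents_wordComponent hF sub_lie lie_sub fun i => by simp [bchCoeff_singleton]

/-- `toEnvCompletion` as a linear map. -/
def toEnvCompletionLinear (F : ℕ → Submodule K L) : L →ₗ[K] envCompletion F where
  toFun := toEnvCompletion F
  map_add' x y := by
    ext n
    simp [toEnvCompletion]
  map_smul' r x := by
    ext n
    simp [toEnvCompletion]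

theorem toEnvCompletion_lie (F : ℕ → Submodule K L) (x y : L) :
    toEnvCompletionLinear F ⁅x, y⁆ = toEnvCompletionLinear F x * toEnvCompletionLinear F y -
      toEnvCompletionLinear F y * toEnvCompletionLinear F x := by
  ext n
  simp [toEnvCompletionLinear, toEnvCompletion, Ring.lie_def]

/-- The projection of the completed enveloping algebra to `U(L) / U(L)ₙ`. -/
def envProj (F : ℕ → Submodule K L) (n : ℕ) :
    envCompletion F →+* (envIdeal F n).ringCon.Quotient :=
  (Pi.evalRingHom _ n).comp (envCompletion F).val.toRingHom

theorem mem_envCompletionFil {F : ℕ → Submodule K L} {n : ℕ} {x : envCompletion F} :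
    x ∈ envCompletionFil F n ↔ envProj F n x = 0 := Iff.rfl

theorem sub_mem_envCompletionFil {F : ℕ → Submodule K L} {n : ℕ} {x y : envCompletion F} :
    x - y ∈ envCompletionFil F n ↔ envProj F n x = envProj F n y := by
  rw [mem_envCompletionFil, map_sub, sub_eq_zero]

theorem coe_eq_coe_iff_sub_mem (F : ℕ → Submodule K L) (n : ℕ)
    (x y : UniversalEnvelopingAlgebra K L) :
    (x : (envIdeal F n).ringCon.Quotient) = y ↔ x - y ∈ envIdeal F n := by
  rw [RingCon.eq, TwoSidedIdeal.rel_iff]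

theorem envIdeal_antitone (F : ℕ → Submodule K L) : Antitone (envIdeal F) := fun _ _ hmn =>
  TwoSidedIdeal.span_mono fun _ ⟨l, hl, hs, hx⟩ => ⟨l, hl, hmn.trans hs, hx⟩

/-- A common representative at levels `m` and `n` that lies in the smaller ideal `envIdeal F n` also
lies in `envIdeal F m`. -/
theorem envCompletionFil_antitone (F : ℕ → Submodule K L) : Antitone (envCompletionFil F) := by
  intro m n hmn x hx
  obtain ⟨y, hm, hn⟩ := x.2 m n hmn
  change x.1 n = 0 at hx
  change x.1 m = 0
  rw [← hm, ← RingCon.coe_zero, coe_eq_coe_iff_sub_mem]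
  rw [← hn, ← RingCon.coe_zero, coe_eq_coe_iff_sub_mem] at hx
  exact envIdeal_antitone F hmn hx

theorem envProj_prod (F : ℕ → Submodule K L) (n : ℕ) (l : List L) :
    envProj F n (l.map (toEnvCompletion F)).prod =
      ((l.map (UniversalEnvelopingAlgebra.ι K)).prod : UniversalEnvelopingAlgebra K L) := by
  induction l with
  | nil => simp
  | cons a l ih => rw [List.map_cons, List.prod_cons, map_mul, ih]; rfl

/-- The exponential of a Lie algebra with values in its completed enveloping algebra. -/
theorem isExpSetting_envCompletion (F : ℕ → Submodule K L) :
    IsExpSetting F (envCompletionFil F) (toEnvCompletion F) where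
  antitone := envCompletionFil_antitone F
  mul_left_mem n _ x hx y := by
    rw [mem_envCompletionFil] at *
    rw [map_mul, hx, mul_zero]
  mul_right_mem n _ x hx y := by
    rw [mem_envCompletionFil] at *
    rw [map_mul, hx, zero_mul]
  map_sub_mem n _ a b h := by
    rw [sub_mem_envCompletionFil]
    change ((UniversalEnvelopingAlgebra.ι K a : UniversalEnvelopingAlgebra K L) :
      (envIdeal F n).ringCon.Quotient) =
        (UniversalEnvelopingAlgebra.ι K b : UniversalEnvelopingAlgebra K L)
    rw [coe_eq_coe_iff_sub_mem]
    exact TwoSidedIdeal.subset_span ⟨[(n, a - b)], by simpa using h, by simp, by simp⟩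
  prod_mem l _ h := by
    rw [mem_envCompletionFil, envProj_prod, ← RingCon.coe_zero, coe_eq_coe_iff_sub_mem, sub_zero]
    refine TwoSidedIdeal.subset_span ⟨l.map fun a => (1, a), ?_, ?_, ?_⟩
    · simpa using h
    · simp [Function.comp_def]
    · rw [List.map_map]; rfl
  separated x hx := by
    ext n
    exact envCompletionFil_antitone F (Nat.le_succ n) (hx (n + 1) (by omega))
  complete f hf := by
    -- The projections to level `m` are constant from index `m + 1` on, and these stable values form
    -- the limit. The shift by one is needed as the hypothesis starts at level `1`.
    have key : ∀ m n, m ≤ n → envProj F m (f (m + 1)) = envProj F m (f (n + 1)) := by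
      intro m n hmn
      rw [← sub_mem_envCompletionFil]
      exact envCompletionFil_antitone F (Nat.le_succ m) (hf _ _ (by omega) (by omega))
    refine ⟨⟨fun m => envProj F m (f (m + 1)), fun m n hmn => ?_⟩, fun n hn => ?_⟩
    · obtain ⟨y, hm, hn⟩ := (f (n + 1)).2 m n hmn
      exact ⟨y, hm.trans (key m n hmn).symm, hn⟩
    · rw [sub_mem_envCompletionFil]
      exact sub_mem_envCompletionFil.1 (hf n (n + 1) hn (by omega))

end Lie

end BCHRec

end

theorem mainTheorem2 (K : Type*) [Field K] [CharZero K] :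
    -- unital associative algebras
    (∀ (A : Type*) [Ring A] [Algebra K A] (F : ℕ → Submodule K A) (P : A →ₗ[K] A),
      BCHRec.IsCompleteFiltration (fun a b => a * b) F →
      (∀ n, ∀ x ∈ F n, P x ∈ F n) →
      (∀ u ∈ F 1, ∀ v ∈ F 1,
        BCHRec.Converges F (BCHRec.assocCPartial K u v) (BCHRec.assocC F u v)) ∧
      (∀ a ∈ F 1, BCHRec.Converges F (BCHRec.expPartial K a) (BCHRec.filExp F a)) ∧
      BCHRec.Factorization F (BCHRec.assocC F) P (BCHRec.filExp F)) ∧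
    -- associative algebras that need not be unital; the exponentials live in `K ⊕ A`
    (∀ (A : Type*) [NonUnitalRing A] [Module K A] [IsScalarTower K A A] [SMulCommClass K A A]
      (F : ℕ → Submodule K A) (P : A →ₗ[K] A),
      BCHRec.IsCompleteFiltration (fun a b => a * b) F →
      (∀ n, ∀ x ∈ F n, P x ∈ F n) →
      (∀ u ∈ F 1, ∀ v ∈ F 1,
        BCHRec.Converges F (BCHRec.assocCPartial K u v) (BCHRec.assocC F u v)) ∧
      (∀ a ∈ F 1, BCHRec.Converges (BCHRec.unitizationFil F)
        (BCHRec.expPartial K (a : Unitization K A))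
        (BCHRec.filExp (BCHRec.unitizationFil F) (a : Unitization K A))) ∧
      BCHRec.Factorization F (BCHRec.assocC F) P
        (fun a => BCHRec.filExp (BCHRec.unitizationFil F) (a : Unitization K A))) ∧
    -- Lie algebras; the exponentials live in the completed enveloping algebra
    (∀ (L : Type*) [LieRing L] [LieAlgebra K L] (F : ℕ → Submodule K L) (P : L →ₗ[K] L),
      BCHRec.IsCompleteFiltration (fun a b => ⁅a, b⁆) F →
      (∀ n, ∀ x ∈ F n, P x ∈ F n) →
      (∀ u ∈ F 1, ∀ v ∈ F 1,
        BCHRec.Converges F (BCHRec.lieCPartial K u v) (BCHRec.lieC F u v)) ∧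
      (∀ a ∈ F 1, BCHRec.Converges (BCHRec.envCompletionFil F)
        (BCHRec.expPartial K (BCHRec.toEnvCompletion F a))
        (BCHRec.filExp (BCHRec.envCompletionFil F) (BCHRec.toEnvCompletion F a))) ∧
      BCHRec.Factorization F (BCHRec.lieC F) P
        (fun a => BCHRec.filExp (BCHRec.envCompletionFil F) (BCHRec.toEnvCompletion F a))) := by
  -- `assocC` and `lieC` are by definition `seriesC` of their components, so all three cases are
  -- instances of `IsExpSetting.main`.
  refine ⟨?_, ?_, ?_⟩
  · intro A _ _ F P hF hP
    exact BCHRec.IsExpSetting.main hF hP (BCHRec.isComponents_assocComponent hF)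
      (BCHRec.isExpSetting_id hF)
      fun u v N => BCHRec.map_assocCPartial (LinearMap.id : A →ₗ[K] A) (fun _ _ => rfl) u v N
  · intro A _ _ _ _ F P hF hP
    have he : ∀ x y : A, Unitization.inrHom K K A (x * y) =
        Unitization.inrHom K K A x * Unitization.inrHom K K A y := fun x y =>
      Unitization.inr_mul K x y
    exact BCHRec.IsExpSetting.main hF hP (BCHRec.isComponents_assocComponent hF)
      (BCHRec.isExpSetting_unitization hF)
      fun u v N => BCHRec.map_assocCPartial (Unitization.inrHom K K A) he u v N
  · intro L _ _ F P hF hP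
    exact BCHRec.IsExpSetting.main hF hP (BCHRec.isComponents_lieComponent hF)
      (BCHRec.isExpSetting_envCompletion F)
      (BCHRec.map_lieCPartial (BCHRec.toEnvCompletionLinear F) (BCHRec.toEnvCompletion_lie F))
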